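/- **Setting.** Let $(\mathfrak X,w)$ be a finite pure $n$-dimensional weighted simplicial complex: $\mathfrak X$ is a non-empty finite downward closed family of finite sets (faces; the dimension of a face is its size, and $\emptyset$ is a face), every face is contained in a face of size $n$, and $w>0$ on $\mathfrak X(n)$, where $\mathfrak X(k)$ is the set of faces of size $k$. Let $\pi_n\propto w$ on $\mathfrak X(n)$, and for $k\le n$ let $\pi_k$ be the law of a uniformly random $k$-element subset of $\sigma\sim\pi_n$. For $\tau\in\mathfrak X(k)$ the link is $\mathfrak X_\tau=\{\xi:\xi\cap\tau=\emptyset,\ \tau\cup\xi\in\mathfrak X\}$, pure of dimension $n-k$ with weights $w_\tau(\xi)=w(\tau\cup\xi)$, and $\pi_{\tau,j}$ denotes the corresponding distribution on $\mathfrak X_\tau(j)$. For $0\le r<s\le n$, the order-$(s,r)$ down-up walk $P^\vee_{s,r}$ on $\mathfrak X(s)$ removes $s-r$ uniformly random elements from the current face to get $\tau\in\mathfrak X(r)$, samples $\xi\sim\pi_{\tau,s-r}$, and moves to $\tau\cup\xi$; its stationary distribution is $\pi_s$. The order-$(r,s)$ up-down walk $P^\wedge_{r,s}$ on $\mathfrak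 X(r)$ samples $\xi\sim\pi_{\tau,s-r}$ from the current face $\tau$ and then removes $s-r$ uniformly random elements from $\tau\cup\xi$; its stationary distribution is $\pi_r$. For $\tau\in\mathfrak X(k)$, $k\le n-2$, the local walk $P_\tau$ on $\mathfrak X_\tau(1)$ moves from $i$ to an element distributed as $\pi_{\tau\cup\{i\},1}$, and $\lambda_2(P_\tau)$ is its second largest eigenvalue. For a distribution $\mu$ and a transition matrix $P$ on a finite set, $P$ satisfies the modified log-Sobolev inequality (MLSI) with constant $\rho$ if $\rho\,\mathrm{Ent}_\mu(f)\le\frac12\sum_{x,y}\mu(x)P(x,y)(f(x)-f(y))(\log f(x)-\log f(y))$ for all $f\ge0$, where $\mathrm{Ent}_\mu(f)=\mu(f\log f)-\mu(f)\log\mu(f)$, $0\log 0=0$, $\log 0=-\infty$, and summands with a zero factor are zero. Its mixing time is $T_{\mathrm{mix}}(P,\varepsilon)=\max_x\min\{t\ge0:\|P^t(x,\cdot)-\mu\|_{TV}\le\varepsilon\}$. **Theorem.** Let $b_0,\dots,b_{n-1}>0$ and $\zeta_0,\dots,\zeta_{n-2}\in[0,1]$. Suppose that $(\mathfrak X,w)$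 is $(b_0,\dots,b_{n-1})$-marginally bounded, i.e. $\pi_{\tau,1}(i)\ge b_k$ for all $0\le k\le n-1$, $\tau\in\mathfrak X(k)$, $i\in\mathfrak X_\tau(1)$, and a $(\zeta_0,\dots,\zeta_{n-2})$-local spectral expander, i.e. $\lambda_2(P_\tau)\le\zeta_k$ for all $0\le k\le n-2$, $\tau\in\mathfrak X(k)$. Then for all $0\le r<s\le n$, both $P^\vee_{s,r}$ (with respect to $\pi_s$) and $P^\wedge_{r,s}$ (with respect to $\pi_r$) satisfy the MLSI with constant $$\kappa=\frac{\sum_{k=r}^{s-1}\Gamma_k}{\sum_{k=0}^{s-1}\Gamma_k},\qquad \Gamma_0=1,\quad \Gamma_k=\prod_{j=0}^{k-1}\alpha_j\ (1\le k\le s-1),$$ $$\alpha_k=\max\left\{1-\frac{4\zeta_k}{b_k^2(s-k)^2},\ \frac{1-\zeta_k}{4+2\log\left(\frac1{2b_kb_{k+1}}\right)}\right\}\quad(0\le k\le s-2).$$ Furthermore, if $\kappa>0$, then for every $\varepsilon\in(0,1)$ $$T_{\mathrm{mix}}(P^\vee_{s,r},\varepsilon)\le\max\left\{0,\left\lceil\frac1\kappa\left(\log\log\frac1{\pi_s^*}+\log\frac1{2\varepsilon^2}\right)\right\rceil\right\},\qquad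 \pi_s^*=\min_{\sigma\in\mathfrak X(s)}\pi_s(\sigma),$$ and the same bound holds for $T_{\mathrm{mix}}(P^\wedge_{r,s},\varepsilon)$ with $\pi_s^*$ replaced by $\pi_r^*=\min_{\tau\in\mathfrak X(r)}\pi_r(\tau)$. (If $\pi^*=1$, so that $\log\log(1/\pi^*)=-\infty$, the bound is $0$.) -/

import Mathlib

open Finset

noncomputable section

/-! ### Finite Markov chains -/

/-- The entropy `Ent_μ(f) = μ(f log f) - μ(f) log μ(f)` of a nonnegative function, with
`0 log 0 = 0` (which holds for `Real.log`). -/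
def chainEnt {Ω : Type*} [Fintype Ω] (μ f : Ω → ℝ) : ℝ :=
  (∑ x, μ x * (f x * Real.log (f x))) - (∑ x, μ x * f x) * Real.log (∑ x, μ x * f x)

/-- The logarithm of a nonnegative real with `log 0 = -∞`. -/
def extLog (a : ℝ) : EReal := ENNReal.log (ENNReal.ofReal a)

/-- The Dirichlet form `½ ∑_{x,y} μ(x) P(x,y) (f(x) - f(y)) (g(x) - g(y))`.  The second argument
may take the value `-∞`; products with a zero factor are zero. -/
def dirichletForm {Ω : Type*} [Fintype Ω] (μ : Ω → ℝ) (P : Matrix Ω Ω ℝ)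
    (f : Ω → ℝ) (g : Ω → EReal) : EReal :=
  ((1 / 2 : ℝ) : EReal) *
    ∑ x, ∑ y, ((μ x * P x y : ℝ) : EReal) * (((f x - f y : ℝ) : EReal) * (g x - g y))

/-- The modified log-Sobolev inequality with constant `ρ` for the chain `P` with stationary
distribution `μ`: for all `f ≥ 0`, `ρ Ent(f) ≤ ℰ_P(f, log f)`.  The right-hand side is `+∞` when
the chain can move between a zero and a nonzero of `f`. -/
def ModifiedLogSobolev {Ω : Type*} [Fintype Ω] (μ : Ω → ℝ) (P : Matrix Ω Ω ℝ) (ρ : ℝ) : Prop :=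
  ∀ f : Ω → ℝ, (∀ x, 0 ≤ f x) →
    ((ρ * chainEnt μ f : ℝ) : EReal) ≤ dirichletForm μ P f (fun x => extLog (f x))

/-- Total variation distance between two distributions on a finite set. -/
def tvDistance {Ω : Type*} [Fintype Ω] (μ ν : Ω → ℝ) : ℝ := (1 / 2) * ∑ x, |μ x - ν x|

/-- The mixing time `max_x min {t ≥ 0 : ‖P^t(x, ·) - μ‖_TV ≤ ε}`; it is `⊤` if from some starting
state the distance never drops to `ε`. -/
def mixingTime {Ω : Type*} [Fintype Ω] [DecidableEq Ω] (μ : Ω → ℝ) (P : Matrix Ω Ω ℝ) (ε : ℝ) :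
    ℕ∞ :=
  ⨆ x : Ω, ⨅ (t : ℕ) (_ : tvDistance ((P ^ t) x) μ ≤ ε), (t : ℕ∞)

/-- The second largest eigenvalue, counted with multiplicity, of a real matrix with real spectrum
(and at least two rows). -/
def secondEigenvalue {Ω : Type*} [Fintype Ω] [DecidableEq Ω] (P : Matrix Ω Ω ℝ) : ℝ :=
  (P.charpoly.roots.sort (· ≥ ·)).getD 1 0

/-! ### Pure weighted simplicial complexes -/

/-- A (finite) pure weighted simplicial complex with positive weights on the maximal faces.
The dimension of a face is its number of elements, and the empty set is a face. -/
structure PureWeightedComplex (U : Type*) where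
  /-- the dimension of the complex -/
  dim : ℕ
  /-- the faces -/
  faces : Finset (Finset U)
  empty_mem : ∅ ∈ faces
  down_closed : ∀ σ ∈ faces, ∀ τ, τ ⊆ σ → τ ∈ faces
  pure : ∀ τ ∈ faces, ∃ σ ∈ faces, τ ⊆ σ ∧ #σ = dim
  /-- the weight function; only its values on faces of size `dim` matter -/
  w : Finset U → ℝ
  w_pos : ∀ σ ∈ faces, #σ = dim → 0 < w σ

namespace PureWeightedComplex

variable {U : Type*}

/-- `𝔛(k)`: the faces of size `k`. -/
def level (X : PureWeightedComplex U) (k : ℕ) : Finset (Finset U) :=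
  X.faces.filter (fun σ => #σ = k)

theorem mem_faces (X : PureWeightedComplex U) {k : ℕ} (τ : X.level k) : τ.1 ∈ X.faces :=
  (Finset.mem_filter.mp τ.2).1

variable [DecidableEq U]

/-- The distribution `π_n ∝ w` on the maximal faces. -/
def topProb (X : PureWeightedComplex U) (σ : Finset U) : ℝ :=
  X.w σ / ∑ σ' ∈ X.level X.dim, X.w σ'

/-- The distribution `π_k` on `𝔛(k)`: sample `σ` from `π_n`, then a uniformly random subset of
`σ` of size `k`.  This is the probability of obtaining `τ ∈ 𝔛(k)`. -/
def prob (X : PureWeightedComplex U) (k : ℕ) (τ : Finset U) : ℝ :=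
  ∑ σ ∈ X.level X.dim with τ ⊆ σ, X.topProb σ * (1 / (X.dim.choose k : ℝ))

/-- `π_k` as a function on `𝔛(k)`. -/
def dist (X : PureWeightedComplex U) (k : ℕ) : X.level k → ℝ := fun τ => X.prob k τ.1

/-- The link `(𝔛_τ, w_τ)` of a face `τ`. -/
def link (X : PureWeightedComplex U) (τ : Finset U) (hτ : τ ∈ X.faces) :
    PureWeightedComplex U where
  dim := X.dim - #τ
  faces := (X.faces.image (fun σ => σ \ τ)).filter (fun ξ => Disjoint τ ξ ∧ τ ∪ ξ ∈ X.faces)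
  empty_mem := by
    simp only [mem_filter, mem_image]
    exact ⟨⟨τ, hτ, by simp⟩, by simp, by simpa using hτ⟩
  down_closed := by
    intro ξ hξ η hη
    simp only [mem_filter, mem_image] at hξ ⊢
    obtain ⟨-, hd, hm⟩ := hξ
    have hd' : Disjoint τ η := hd.mono_right hη
    have hm' : τ ∪ η ∈ X.faces := X.down_closed _ hm _ (union_subset_union_right hη)
    exact ⟨⟨τ ∪ η, hm', union_sdiff_cancel_left hd'⟩, hd', hm'⟩
  pure := by
    intro ξ hξ
    simp only [mem_filter, mem_image] at hξ
    obtain ⟨-, hd, hm⟩ := hξ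
    obtain ⟨σ, hσ, hsub, hc⟩ := X.pure _ hm
    have hτσ : τ ⊆ σ := subset_union_left.trans hsub
    refine ⟨σ \ τ, ?_, ?_, ?_⟩
    · simp only [mem_filter, mem_image]
      exact ⟨⟨σ, hσ, rfl⟩, disjoint_sdiff, by rwa [union_sdiff_of_subset hτσ]⟩
    · exact subset_sdiff.mpr ⟨subset_union_right.trans hsub, hd.symm⟩
    · rw [card_sdiff_of_subset hτσ, hc]
  w := fun ξ => X.w (τ ∪ ξ)
  w_pos := by
    intro ξ hξ hc
    simp only [mem_filter, mem_image] at hξ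
    obtain ⟨-, hd, hm⟩ := hξ
    refine X.w_pos _ hm ?_
    obtain ⟨σ, -, hsub, hσ⟩ := X.pure τ hτ
    have := card_le_card hsub
    rw [card_union_of_disjoint hd]
    omega

/-- The faces of the link are the sets disjoint from `τ` whose union with `τ` is a face. -/
theorem mem_link_faces (X : PureWeightedComplex U) (τ : Finset U) (hτ : τ ∈ X.faces)
    (ξ : Finset U) : ξ ∈ (X.link τ hτ).faces ↔ Disjoint τ ξ ∧ τ ∪ ξ ∈ X.faces := by
  simp only [link, mem_filter, mem_image, and_iff_right_iff_imp]
  rintro ⟨hd, hm⟩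
  exact ⟨τ ∪ ξ, hm, union_sdiff_cancel_left hd⟩

theorem union_mem_faces (X : PureWeightedComplex U) (τ : Finset U) (hτ : τ ∈ X.faces) {k : ℕ}
    (ξ : (X.link τ hτ).level k) : τ ∪ ξ.1 ∈ X.faces :=
  ((X.mem_link_faces τ hτ ξ.1).mp ((X.link τ hτ).mem_faces ξ)).2

/-- From `σ ∈ 𝔛(s)`, remove `s - r` uniformly random elements to get `τ ∈ 𝔛(r)`. -/
def downKernel (X : PureWeightedComplex U) (s r : ℕ) : Matrix (X.level s) (X.level r) ℝ :=
  fun σ τ => if τ.1 ⊆ σ.1 then 1 / (s.choose r : ℝ) else 0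

/-- From `τ ∈ 𝔛(r)`, sample `ξ ∈ 𝔛_τ(s-r)` from `π_{τ,s-r}` and move to `τ ∪ ξ ∈ 𝔛(s)`. -/
def upKernel (X : PureWeightedComplex U) (r s : ℕ) : Matrix (X.level r) (X.level s) ℝ :=
  fun τ σ =>
    if τ.1 ⊆ σ.1 then (X.link τ.1 (X.mem_faces τ)).prob (s - r) (σ.1 \ τ.1) else 0

/-- The order-`(s,r)` down-up walk on `𝔛(s)`. -/
def downUpWalk (X : PureWeightedComplex U) (s r : ℕ) : Matrix (X.level s) (X.level s) ℝ :=
  X.downKernel s r * X.upKernel r s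

/-- The order-`(r,s)` up-down walk on `𝔛(r)`. -/
def upDownWalk (X : PureWeightedComplex U) (r s : ℕ) : Matrix (X.level r) (X.level r) ℝ :=
  X.upKernel r s * X.downKernel s r

/-- The local walk at `τ` on `𝔛_τ(1)`: from `i`, the next element has law `π_{τ ∪ {i}, 1}`.
(The elements of `𝔛_τ(1)` are singletons; the entry vanishes when `i = j` or when `{i, j}` is not
a face of the link.) -/
def localWalk (X : PureWeightedComplex U) (τ : Finset U) (hτ : τ ∈ X.faces) :
    Matrix ((X.link τ hτ).level 1) ((X.link τ hτ).level 1) ℝ :=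
  fun i j => (X.link (τ ∪ i.1) (X.union_mem_faces τ hτ i)).prob 1 j.1

/-- `(b_0, …, b_{n-1})`-marginal boundedness; only `b k` with `k < n` matter. -/
def MarginallyBounded (X : PureWeightedComplex U) (b : ℕ → ℝ) : Prop :=
  ∀ (τ : Finset U) (hτ : τ ∈ X.faces), #τ < X.dim →
    ∀ i ∈ (X.link τ hτ).level 1, b #τ ≤ (X.link τ hτ).prob 1 i

/-- `(ζ_0, …, ζ_{n-2})`-local spectral expansion; only `ζ k` with `k + 2 ≤ n` matter. -/
def LocalSpectralExpander (X : PureWeightedComplex U) (ζ : ℕ → ℝ) : Prop :=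
  ∀ (τ : Finset U) (hτ : τ ∈ X.faces), #τ + 2 ≤ X.dim →
    secondEigenvalue (X.localWalk τ hτ) ≤ ζ #τ

/-- `π_k^* = min_{σ ∈ 𝔛(k)} π_k(σ)`. -/
def minProb (X : PureWeightedComplex U) (k : ℕ) : ℝ := ⨅ σ : X.level k, X.dist k σ

end PureWeightedComplex

/-! ### The constants -/

/-- `α_k = max {1 - 4 ζ_k / (b_k² (s-k)²), (1 - ζ_k) / (4 + 2 log (1 / (2 b_k b_{k+1})))}`. -/
def alphaConst (b ζ : ℕ → ℝ) (s k : ℕ) : ℝ :=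
  max (1 - 4 * ζ k / (b k ^ 2 * ((s : ℝ) - (k : ℝ)) ^ 2))
    ((1 - ζ k) / (4 + 2 * Real.log (1 / (2 * b k * b (k + 1)))))

/-- `Γ_k = ∏_{j < k} α_j`, so `Γ_0 = 1`. -/
def GammaConst (b ζ : ℕ → ℝ) (s k : ℕ) : ℝ := ∏ j ∈ range k, alphaConst b ζ s j

/-- `κ(r,s) = (∑_{k=r}^{s-1} Γ_k) / (∑_{k=0}^{s-1} Γ_k)`. -/
def kappaConst (b ζ : ℕ → ℝ) (r s : ℕ) : ℝ :=
  (∑ k ∈ Ico r s, GammaConst b ζ s k) / ∑ k ∈ range s, GammaConst b ζ s k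

/-- The bound `⌈(1/κ) (log log (1/p) + log (1/(2ε²)))⌉`, read as `0` when it is negative; in
particular it is `0` if `p = 1`, where `log log (1/p) = log 0 = -∞`. -/
def mixingBound (κ p ε : ℝ) : ℕ :=
  if p = 1 then 0
  else ⌈1 / κ * (Real.log (Real.log (1 / p)) + Real.log (1 / (2 * ε ^ 2)))⌉₊

end

noncomputable section

/-! ### Elementary inequalities for the logarithm -/

/-! Fix `f ≥ 0` on `𝔛(s)`. For a face `ρ` of size at most `s` let `F(ρ)` be the conditional
expectation of `f` given that the random `s`-face contains `ρ`, and let `H_k` be the `π_k`-average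
of `F log F`. Then `H_k - H_0` is the entropy of `F` on level `k`: it is `Ent(f)` for `k = s`, and
for `k = r` the entropy of the image of `f` under the up kernel. Everything rests on comparing the
increments `Δ_k = H_{k+1} - H_k`, namely `α_k Δ_k ≤ Δ_{k+1}`. Given this, `Δ_k / Γ_k` is
nondecreasing in spirit, so the first `r` increments make up at most the fraction `1 - κ` of all `s`
of them (`sum_range_le_of_growth`). Hence the up kernel contracts entropy by `1 - κ`
(`chainEnt_upKernel_le`).

The growth of increments is local: conditioned on `τ ∈ 𝔛(k)`, it compares vertices and edges of the
link of `τ`, with spectral input from the local walk (`local_entropy_growth`). Two independent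
arguments give the two terms in the maximum `α_k`. The first applies Gibbs' inequality to `F` on
edges against the product of its vertex averages; the error is a covariance, bounded by `ζ` times a
variance, and the variance is bounded by entropy because marginal boundedness caps the vertex
averages (`entropy_growth_of_bounded`). The second passes to `√F`: variance on edges controls
entropy on edges up to `2 + L`, spectral expansion shows that a fraction `(1 - ζ)/2` of that
variance is conditional on a vertex, and conditional variance is at most conditional entropy
(`entropy_growth_of_weight_ge`).

The down kernel is adjoint to the up kernel and cannot increase entropy, so both two-step walks
contract entropy by `1 - κ`. By Gibbs' inequality `ℰ(f, log f) ≥ Ent(f) - Ent(Pf)`, which gives the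
MLSI; iterating the contraction from a point mass and applying Pinsker's inequality gives the mixing
time. -/

theorem pade_le_log {x : ℝ} (hx : 0 < x) :
    (x - 1) * (5 * x + 1) / (2 * x * (x + 2)) ≤ Real.log x := by
  set q : ℝ → ℝ := fun x => Real.log x - (x - 1) * (5 * x + 1) / (2 * x * (x + 2)) with hq
  -- The derivative has the sign of `y - 1`, so `q` attains its minimum, which is `0`, at `1`.
  have hd : ∀ y : ℝ, 0 < y → HasDerivAt q ((y - 1) ^ 3 / (y ^ 2 * (y + 2) ^ 2)) y := by
    intro y hy
    have h1 := Real.hasDerivAt_log hy.ne'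
    have hn : HasDerivAt (fun x : ℝ => (x - 1) * (5 * x + 1)) (1 * (5 * y + 1) + (y - 1) * (5 * 1))
        y := ((hasDerivAt_id y).sub_const 1).mul (((hasDerivAt_id y).const_mul 5).add_const 1)
    have hden : HasDerivAt (fun x : ℝ => 2 * x * (x + 2)) (2 * 1 * (y + 2) + 2 * y * 1) y :=
      ((hasDerivAt_id y).const_mul 2).mul ((hasDerivAt_id y).add_const 2)
    have h2 := h1.sub (hn.div hden (by positivity))
    refine h2.congr_deriv ?_
    field_simp
    ring
  have hcont : ∀ s ⊆ Set.Ioi (0 : ℝ), ContinuousOn q s := fun s hs y hy =>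
    (hd y (hs hy)).continuousAt.continuousWithinAt
  have key : q 1 ≤ q x := by
    rcases le_total x 1 with h | h
    · have : AntitoneOn q (Set.Ioc 0 1) := by
        refine antitoneOn_of_deriv_nonpos (convex_Ioc 0 1) (hcont _ fun y hy => hy.1) ?_ ?_
        · intro y hy
          rw [interior_Ioc] at hy
          exact (hd y hy.1).differentiableAt.differentiableWithinAt
        · intro y hy
          rw [interior_Ioc] at hy
          rw [(hd y hy.1).deriv]
          refine div_nonpos_of_nonpos_of_nonneg ?_ (by positivity)
          have : (y - 1) ^ 3 = (y - 1) ^ 2 * (y - 1) := by ring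
          rw [this]
          exact mul_nonpos_of_nonneg_of_nonpos (sq_nonneg _) (by linarith [hy.2])
      exact this ⟨hx, h⟩ ⟨one_pos, le_rfl⟩ h
    · have : MonotoneOn q (Set.Ici 1) := by
        refine monotoneOn_of_deriv_nonneg (convex_Ici 1)
          (hcont _ fun y hy => Set.mem_Ioi.mpr (one_pos.trans_le hy)) ?_ ?_
        · intro y hy
          rw [interior_Ici] at hy
          exact (hd y (one_pos.trans hy)).differentiableAt.differentiableWithinAt
        · intro y hy
          rw [interior_Ici] at hy
          rw [(hd y (one_pos.trans hy)).deriv]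
          have : 0 ≤ y - 1 := by linarith [Set.mem_Ioi.mp hy]
          positivity
      exact this (Set.mem_Ici.mpr le_rfl) h h
  simp only [hq, Real.log_one] at key
  linarith

theorem log_one_add_le_pade {h : ℝ} (hh : -1 < h) :
    Real.log (1 + h) ≤ h * (6 + h) / (6 + 4 * h) := by
  have h0 : 0 < 1 + h := by linarith
  have := pade_le_log (inv_pos.mpr h0)
  rw [Real.log_inv] at this
  have e : ((1 + h)⁻¹ - 1) * (5 * (1 + h)⁻¹ + 1) / (2 * (1 + h)⁻¹ * ((1 + h)⁻¹ + 2)) =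
      -(h * (6 + h) / (6 + 4 * h)) := by
    have h1 : (6 + 4 * h) ≠ 0 := by linarith
    have h2 : (1 + h)⁻¹ + 2 ≠ 0 := by positivity
    have h3 : 3 + 2 * h ≠ 0 := by linarith
    have : (1 + h)⁻¹ + 2 = (3 + 2 * h) / (1 + h) := by field_simp; ring
    rw [this]
    have h4 : 6 + 4 * h = 2 * (3 + 2 * h) := by ring
    rw [h4]
    field_simp
    ring
  rw [e] at this
  linarith

/-- The inequality between divergences that yields Pinsker's inequality. -/
theorem three_mul_sq_le_mul_log {x : ℝ} (hx : 0 ≤ x) :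
    3 * (x - 1) ^ 2 ≤ (2 * x + 4) * (x * Real.log x - x + 1) := by
  rcases hx.eq_or_lt with rfl | hx
  · norm_num
  have h := pade_le_log hx
  rw [div_le_iff₀ (by positivity)] at h
  nlinarith

theorem sq_sqrt_sub_one_le {x : ℝ} (hx : 0 ≤ x) :
    (√x - 1) ^ 2 ≤ x * Real.log x - x + 1 := by
  rcases hx.eq_or_lt with rfl | hx
  · norm_num
  have hs : 0 < √x := Real.sqrt_pos.mpr hx
  have h1 : Real.log x = 2 * Real.log (√x) := by rw [Real.log_sqrt hx.le]; ring
  have h2 := Real.one_sub_inv_le_log_of_pos hs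
  have h3 : √x * √x = x := Real.mul_self_sqrt hx.le
  have h4 : x * (1 - (√x)⁻¹) = x - √x := by
    rw [mul_sub, mul_one]; congr 1; rw [← div_eq_mul_inv, div_eq_iff hs.ne', h3]
  have := mul_le_mul_of_nonneg_left h2 hx.le
  rw [h1]
  nlinarith

/-- Factor `x - 1 = (√x + 1)(√x - 1)`: the second factor is controlled by the divergence, and the
first is at most `2K`. This converts variance into entropy for bounded densities. -/
theorem sq_sub_one_le_of_le {x K : ℝ} (hx : 0 ≤ x) (hxK : x ≤ K) (hK : 1 ≤ K) :
    (x - 1) ^ 2 ≤ 4 * K ^ 2 * (x * Real.log x - x + 1) := by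
  have h := sq_sqrt_sub_one_le hx
  have hs := Real.sqrt_nonneg x
  have h3 : √x * √x = x := Real.mul_self_sqrt hx
  have hsK : √x ≤ K := by
    rw [Real.sqrt_le_iff]
    exact ⟨by linarith, by nlinarith⟩
  have e : (x - 1) ^ 2 = (√x + 1) ^ 2 * (√x - 1) ^ 2 := by
    rw [← mul_pow]
    congr 1
    linear_combination -h3
  rw [e]
  have : (√x + 1) ^ 2 ≤ 4 * K ^ 2 := by nlinarith
  exact mul_le_mul this h (sq_nonneg _) (by positivity)

/-- Gibbs' inequality, pointwise: `a log b ≤ a log a - a + b`. -/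
theorem mul_log_le_mul_log_sub_add {a b : ℝ} (ha : 0 ≤ a) (hb : 0 ≤ b) (hab : b = 0 → a = 0) :
    a * Real.log b ≤ a * Real.log a - a + b := by
  rcases ha.eq_or_lt with rfl | ha
  · simpa using hb
  have hb : 0 < b := hb.lt_of_ne fun h => ha.ne' (hab h.symm)
  have h := Real.log_le_sub_one_of_pos (div_pos hb ha)
  rw [Real.log_div hb.ne' ha.ne'] at h
  have h2 := mul_le_mul_of_nonneg_left h ha.le
  have : a * (b / a - 1) = b - a := by field_simp
  linarith

/-- Pointwise form of `Ent(g²) ≤ (2 + L) Var(g)`, with `h = g / 𝔼g - 1` and `c = 𝔼g² / (𝔼g)²`. Since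
`𝔼h = 0` and `𝔼h² = c - 1`, the last coefficient is the one that integrates to exactly `c log c`,
the term subtracted in the entropy. -/
theorem mul_log_sq_le {h L c : ℝ} (hh : -1 ≤ h) (hL : 0 ≤ L) (hc : 1 < c)
    (hlc : (1 + h) ^ 2 ≤ Real.exp L * c) :
    2 * (1 + h) ^ 2 * Real.log (1 + h) ≤
      2 * h + h ^ 2 * (2 + L + c * Real.log c / (c - 1)) := by
  have hc0 : 0 < c - 1 := by linarith
  have hlogc : 0 < Real.log c := Real.log_pos hc
  have hA : 1 + Real.log c / 2 ≤ c * Real.log c / (c - 1) := by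
    have := Real.le_log_one_add_of_nonneg hc0.le
    rw [show 1 + (c - 1) = c by ring, div_le_iff₀ (by linarith)] at this
    rw [le_div_iff₀ hc0]
    nlinarith
  have hB : Real.log c ≤ c * Real.log c / (c - 1) := by
    rw [le_div_iff₀ hc0]
    nlinarith
  rcases hh.eq_or_lt with rfl | hh
  · norm_num
    linarith
  have h1 : 0 < 1 + h := by linarith
  have hl : 2 * Real.log (1 + h) ≤ L + Real.log c := by
    have := Real.log_le_log (by positivity) hlc
    rw [Real.log_pow, Real.log_mul (Real.exp_pos _).ne' (by linarith), Real.log_exp] at this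
    exact_mod_cast this
  have hp := log_one_add_le_pade hh
  set ℓ := Real.log (1 + h)
  set C := c * Real.log c / (c - 1)
  rw [le_div_iff₀ (by linarith)] at hp
  -- The bracket multiplying `h²` is bounded below by `3`, by `3 + ℓ` or by `2 + 2ℓ`, according to
  -- whether `h ≤ 0`, `0 ≤ h ≤ 2` or `h ≥ 2`. The first two cases use the Padé bound, the last the
  -- tangent of the logarithm at `3`.
  rcases le_total h 0 with h0 | h0
  · have : 2 * (1 + h) ^ 2 * ℓ ≤ 2 * h + 3 * h ^ 2 := by
      have h2 : 0 < 6 + 4 * h := by linarith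
      refine le_of_mul_le_mul_right ?_ h2
      have := mul_le_mul_of_nonneg_left hp (by positivity : 0 ≤ 2 * (1 + h) ^ 2)
      have : 0 ≤ (-h) ^ 3 * (2 + h) := mul_nonneg (pow_nonneg (by linarith) 3) (by linarith)
      nlinarith
    nlinarith [sq_nonneg h]
  rcases le_total h 2 with h2 | h2
  · have : (2 + 4 * h + h ^ 2) * ℓ ≤ 2 * h + 3 * h ^ 2 := by
      have h3 : 0 < 6 + 4 * h := by linarith
      refine le_of_mul_le_mul_right ?_ h3
      have := mul_le_mul_of_nonneg_left hp (by positivity : 0 ≤ 2 + 4 * h + h ^ 2)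
      have : 0 ≤ h ^ 3 * (2 - h) := mul_nonneg (by positivity) (by linarith)
      nlinarith
    have : 3 + ℓ ≤ 2 + L + C := by linarith
    have := mul_le_mul_of_nonneg_left this (sq_nonneg h)
    nlinarith
  · have hl3 : Real.log 3 ≤ 1.1932 := by
      have h3 : Real.log 3 = Real.log 2 + Real.log (3 / 2) := by
        rw [← Real.log_mul (by norm_num) (by norm_num)]; norm_num
      have := Real.log_two_lt_d9
      have := Real.log_le_sub_one_of_pos (by norm_num : (0 : ℝ) < 3 / 2)
      linarith
    have hℓ : ℓ ≤ 1.1932 + (h - 2) / 3 := by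
      have h3 := Real.log_le_sub_one_of_pos (by positivity : (0 : ℝ) < (1 + h) / 3)
      rw [Real.log_div h1.ne' (by norm_num)] at h3
      have : ℓ - Real.log 3 ≤ (1 + h) / 3 - 1 := h3
      linarith
    have h4 : (1 + 2 * h) * ℓ ≤ h + h ^ 2 := by
      have := mul_le_mul_of_nonneg_left hℓ (by linarith : 0 ≤ 1 + 2 * h)
      nlinarith
    have : 2 + 2 * ℓ ≤ 2 + L + C := by linarith
    have := mul_le_mul_of_nonneg_left this (sq_nonneg h)
    nlinarith

/-! ### Variance and entropy on a weighted finite set -/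

/-- If `g ≥ 0` and `g² ≤ e^L 𝔼 g²` on the support of a probability weight, then
`Ent(g²) ≤ (2 + L) Var(g)`. -/
theorem entropy_sq_le_variance {Ω : Type*} [Fintype Ω] (p g : Ω → ℝ) (hp : ∀ x, 0 ≤ p x)
    (hp1 : ∑ x, p x = 1) (hg : ∀ x, 0 ≤ g x) {L : ℝ} (hL : 0 ≤ L)
    (hbd : ∀ x, 0 < p x → g x ^ 2 ≤ Real.exp L * ∑ y, p y * g y ^ 2) :
    ∑ x, p x * (g x ^ 2 * Real.log (g x ^ 2)) -
        (∑ x, p x * g x ^ 2) * Real.log (∑ x, p x * g x ^ 2) ≤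
      (2 + L) * (∑ x, p x * g x ^ 2 - (∑ x, p x * g x) ^ 2) := by
  set m := ∑ x, p x * g x with hm
  set q := ∑ x, p x * g x ^ 2 with hq
  have hm0 : 0 ≤ m := sum_nonneg fun x _ => mul_nonneg (hp x) (hg x)
  have hvar : ∑ x, p x * (g x - m) ^ 2 = q - m ^ 2 := by
    have : ∀ x, p x * (g x - m) ^ 2 = p x * g x ^ 2 - 2 * m * (p x * g x) + m ^ 2 * p x :=
      fun x => by ring
    simp only [this, sum_add_distrib, sum_sub_distrib, ← mul_sum, hp1, ← hm, ← hq]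
    ring
  have hv : 0 ≤ q - m ^ 2 := hvar ▸ sum_nonneg fun x _ => mul_nonneg (hp x) (sq_nonneg _)
  -- With zero variance `g` is constant on the support. This case is separate because the pointwise
  -- bound divides by `c - 1`.
  rcases hv.eq_or_lt with hv0 | hv0
  · rw [← hv0, mul_zero]
    have hz : ∀ x, p x * (g x - m) ^ 2 = 0 := fun x =>
      (sum_eq_zero_iff_of_nonneg fun x _ => mul_nonneg (hp x) (sq_nonneg _)).mp
        (hvar.trans hv0.symm) x (mem_univ x)
    have hq' : q = m ^ 2 := by linarith
    have : ∀ x, p x * (g x ^ 2 * Real.log (g x ^ 2)) = p x * (m ^ 2 * Real.log (m ^ 2)) := by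
      intro x
      rcases mul_eq_zero.mp (hz x) with h | h
      · simp [h]
      · rw [sub_eq_zero.mp (pow_eq_zero_iff (two_ne_zero) |>.mp h)]
    simp only [this, ← sum_mul, hp1, hq']
    simp
  have hmpos : 0 < m := by
    refine hm0.lt_of_ne fun h => ?_
    have hz : ∀ x, p x * g x = 0 := fun x =>
      (sum_eq_zero_iff_of_nonneg fun x _ => mul_nonneg (hp x) (hg x)).mp
        (hm.symm.trans h.symm) x (mem_univ x)
    have : q = 0 := sum_eq_zero fun x _ => by rw [sq, ← mul_assoc, hz, zero_mul]
    rw [this] at hv0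
    nlinarith
  have hqpos : 0 < q := by nlinarith
  set c := q / m ^ 2 with hc
  have hc1 : 1 < c := by rw [hc, lt_div_iff₀ (by positivity)]; linarith
  have hlogc : Real.log q = Real.log c + 2 * Real.log m := by
    rw [hc, Real.log_div hqpos.ne' (by positivity), Real.log_pow]; push_cast; ring
  have key : ∀ x, p x * (g x ^ 2 * Real.log (g x ^ 2)) ≤
      p x * (2 * m * (g x - m)) + p x * (g x - m) ^ 2 * (2 + L + c * Real.log c / (c - 1)) +
        2 * Real.log m * (p x * g x ^ 2) := by
    intro x
    rcases (hp x).eq_or_lt with h | h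
    · simp [← h]
    have := mul_log_sq_le (h := g x / m - 1) (c := c) (L := L)
      (by have := div_nonneg (hg x) hm0; linarith) hL hc1 (by
        rw [hc, ← mul_div_assoc]
        simp only [add_sub_cancel, div_pow]
        gcongr
        exact hbd x h)
    simp only [add_sub_cancel] at this
    have h2 := mul_le_mul_of_nonneg_left this (by positivity : 0 ≤ m ^ 2)
    have e1 : m ^ 2 * (2 * (g x / m) ^ 2 * Real.log (g x / m)) =
        g x ^ 2 * Real.log (g x ^ 2) - 2 * Real.log m * g x ^ 2 := by
      rcases (hg x).eq_or_lt with h0 | h0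
      · simp [← h0]
      rw [Real.log_div h0.ne' hmpos.ne', Real.log_pow]
      field_simp
      push_cast
      ring
    have e2 : m ^ 2 * (2 * (g x / m - 1) +
        (g x / m - 1) ^ 2 * (2 + L + c * Real.log c / (c - 1))) =
        2 * m * (g x - m) + (g x - m) ^ 2 * (2 + L + c * Real.log c / (c - 1)) := by
      generalize 2 + L + c * Real.log c / (c - 1) = A
      field_simp
    rw [e1, e2] at h2
    have := mul_le_mul_of_nonneg_left h2 h.le
    linarith
  have hsum := sum_le_sum fun x (_ : x ∈ univ) => key x
  have e3 : ∑ x, p x * (2 * m * (g x - m)) = 0 := by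
    have : ∀ x, p x * (2 * m * (g x - m)) = 2 * m * (p x * g x) - 2 * m ^ 2 * p x :=
      fun x => by ring
    simp only [this, sum_sub_distrib, ← mul_sum, hp1, ← hm]
    ring
  rw [sum_add_distrib, sum_add_distrib, e3, ← sum_mul, ← mul_sum, hvar, ← hq] at hsum
  have e4 : (q - m ^ 2) * (c * Real.log c / (c - 1)) = q * Real.log c := by
    have h1 : c - 1 ≠ 0 := by linarith
    have h2 : q = c * m ^ 2 := by rw [hc]; field_simp
    rw [h2]
    field_simp
  rw [hlogc]
  linarith

/-- `Var(g) ≤ Ent(g²)` for a nonnegative function. -/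
theorem variance_le_entropy_sq {Ω : Type*} [Fintype Ω] (p g : Ω → ℝ) (hp : ∀ x, 0 ≤ p x)
    (hg : ∀ x, 0 ≤ g x) :
    ∑ x, p x * g x ^ 2 - (∑ x, p x * g x) ^ 2 ≤
    ∑ x, p x * (g x ^ 2 * Real.log (g x ^ 2)) -
        (∑ x, p x * g x ^ 2) * Real.log (∑ x, p x * g x ^ 2) := by
  set m := ∑ x, p x * g x with hm
  set q := ∑ x, p x * g x ^ 2 with hq
  have hm0 : 0 ≤ m := sum_nonneg fun x _ => mul_nonneg (hp x) (hg x)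
  have hq0 : 0 ≤ q := sum_nonneg fun x _ => mul_nonneg (hp x) (sq_nonneg _)
  rcases hq0.eq_or_lt with hq0 | hq0
  · have hz : ∀ x, p x * g x ^ 2 = 0 := fun x =>
      (sum_eq_zero_iff_of_nonneg fun x _ => mul_nonneg (hp x) (sq_nonneg _)).mp
        (hq.symm.trans hq0.symm) x (mem_univ x)
    have : ∀ x, p x * (g x ^ 2 * Real.log (g x ^ 2)) = 0 := fun x => by
      rw [← mul_assoc, hz, zero_mul]
    simp only [this, ← hq0]
    simp
    positivity
  have hmpos : 0 < m := by
    refine hm0.lt_of_ne fun h => ?_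
    have hz : ∀ x, p x * g x = 0 := fun x =>
      (sum_eq_zero_iff_of_nonneg fun x _ => mul_nonneg (hp x) (hg x)).mp
        (hm.symm.trans h.symm) x (mem_univ x)
    have : q = 0 := sum_eq_zero fun x _ => by rw [sq, ← mul_assoc, hz, zero_mul]
    linarith
  -- Gibbs' inequality for `g²` against `q g / m`
  have key : ∀ x, p x * g x ^ 2 * (Real.log q - 2 * Real.log m) + p x * g x ^ 2 * Real.log q ≤
      p x * (g x ^ 2 * Real.log (g x ^ 2)) + 2 * (q / m * (p x * g x) - p x * g x ^ 2) := by
    intro x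
    rcases (hg x).eq_or_lt with h0 | h0
    · simp [← h0]
    have h := mul_log_le_mul_log_sub_add (sq_nonneg (g x))
      (by positivity : 0 ≤ g x * (q / m)) fun h => absurd h (by positivity)
    rw [Real.log_mul h0.ne' (by positivity), Real.log_div hq0.ne' hmpos.ne', Real.log_pow] at h
    rw [Real.log_pow]
    push_cast at h ⊢
    have := mul_le_mul_of_nonneg_left h (hp x)
    linarith
  have hsum := sum_le_sum fun x (_ : x ∈ univ) => key x
  simp only [sum_add_distrib, ← sum_mul, ← mul_sum, sum_sub_distrib, ← hm, ← hq] at hsum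
  rw [div_mul_cancel₀ _ hmpos.ne', sub_self, mul_zero, add_zero] at hsum
  -- So far `Ent(g²) ≥ q log (q / m²)`; it remains to bound this below by `q - m²`.
  have hl := Real.log_le_sub_one_of_pos (by positivity : 0 < m ^ 2 / q)
  rw [Real.log_div (by positivity) hq0.ne', Real.log_pow] at hl
  push_cast at hl
  have := mul_le_mul_of_nonneg_left hl hq0.le
  have e : q * (m ^ 2 / q - 1) = m ^ 2 - q := by field_simp
  nlinarith

/-- Pinsker's inequality for a density `f`. -/
theorem sq_tv_le_chainEnt {Ω : Type*} [Fintype Ω] (μ f : Ω → ℝ) (hμ : ∀ x, 0 ≤ μ x)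
    (hμ1 : ∑ x, μ x = 1) (hf : ∀ x, 0 ≤ f x) (hf1 : ∑ x, μ x * f x = 1) :
    (∑ x, μ x * |f x - 1|) ^ 2 ≤ 2 * chainEnt μ f := by
  -- Cauchy–Schwarz, splitting `3 (f - 1)² ≤ (2f + 4)(f log f - f + 1)`. The first factor has mean
  -- `6` and the second has mean `Ent(f)`.
  have hcs : (∑ x, μ x * |f x - 1|) ^ 2 ≤
      (∑ x, μ x * (2 * f x + 4)) * ∑ x, μ x * (f x * Real.log (f x) - f x + 1) / 3 := by
    refine sum_sq_le_sum_mul_sum_of_sq_le_mul _ (fun x _ => mul_nonneg (hμ x) (by linarith [hf x]))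
      (fun x _ => ?_) fun x _ => ?_
    · have := Real.self_sub_one_le_mul_log (hf x)
      exact div_nonneg (mul_nonneg (hμ x) (by linarith)) (by norm_num)
    · have h := mul_le_mul_of_nonneg_left (three_mul_sq_le_mul_log (hf x)) (sq_nonneg (μ x))
      rw [mul_pow, sq_abs]
      linarith
  have e1 : ∑ x, μ x * (2 * f x + 4) = 6 := by
    have : ∀ x, μ x * (2 * f x + 4) = 2 * (μ x * f x) + 4 * μ x := fun x => by ring
    simp only [this, sum_add_distrib, ← mul_sum, hf1, hμ1]
    norm_num
  have e2 : ∑ x, μ x * (f x * Real.log (f x) - f x + 1) / 3 = chainEnt μ f / 3 := by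
    rw [← sum_div]
    have : ∀ x, μ x * (f x * Real.log (f x) - f x + 1) =
      μ x * (f x * Real.log (f x)) - μ x * f x + μ x := fun x => by ring
    simp only [this, sum_add_distrib, sum_sub_distrib, hf1, hμ1, chainEnt]
    simp
  rw [e1, e2] at hcs
  linarith

/-! ### Entropy contraction, the modified log-Sobolev inequality and mixing -/

/-- Jensen's inequality for `x log x`. -/
theorem mul_log_sum_le {Ω : Type*} [Fintype Ω] (p f : Ω → ℝ) (hp : ∀ x, 0 ≤ p x)
    (hp1 : ∑ x, p x = 1) (hf : ∀ x, 0 ≤ f x) :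
    (∑ x, p x * f x) * Real.log (∑ x, p x * f x) ≤ ∑ x, p x * (f x * Real.log (f x)) := by
  have := Real.convexOn_mul_log.map_sum_le (t := univ) (w := p) (p := f) (fun x _ => hp x) hp1
    fun x _ => hf x
  simpa only [smul_eq_mul] using this

/-- Averaging over a Markov kernel decreases the entropy. -/
theorem chainEnt_mulVec_le {Ω Ω' : Type*} [Fintype Ω] [Fintype Ω'] (μ : Ω → ℝ) (ν : Ω' → ℝ)
    (K : Matrix Ω Ω' ℝ) (hμ : ∀ x, 0 ≤ μ x) (hK : ∀ x y, 0 ≤ K x y) (hK1 : ∀ x, ∑ y, K x y = 1)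
    (hμK : ∀ y, ∑ x, μ x * K x y = ν y) (f : Ω' → ℝ) (hf : ∀ y, 0 ≤ f y) :
    chainEnt μ (K.mulVec f) ≤ chainEnt ν f := by
  have hm : ∀ g : Ω' → ℝ, ∑ x, μ x * K.mulVec g x = ∑ y, ν y * g y := by
    intro g
    simp only [Matrix.mulVec, dotProduct, mul_sum, ← hμK, sum_mul]
    rw [sum_comm]
    simp only [mul_assoc]
  unfold chainEnt
  rw [hm, ← hm fun y => f y * Real.log (f y)]
  refine sub_le_sub_right (sum_le_sum fun x _ => mul_le_mul_of_nonneg_left ?_ (hμ x)) _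
  exact mul_log_sum_le (K x) f (hK x) (hK1 x) hf

/-- A reversible Markov chain with positive stationary distribution `μ`. -/
structure IsReversibleChain {Ω : Type*} [Fintype Ω] (μ : Ω → ℝ) (P : Matrix Ω Ω ℝ) : Prop where
  pos : ∀ x, 0 < μ x
  sum_eq_one : ∑ x, μ x = 1
  nonneg : ∀ x y, 0 ≤ P x y
  row_sum : ∀ x, ∑ y, P x y = 1
  detailed_balance : ∀ x y, μ x * P x y = μ y * P y x

namespace IsReversibleChain

variable {Ω : Type*} [Fintype Ω] {μ : Ω → ℝ} {P : Matrix Ω Ω ℝ}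

theorem stationary (h : IsReversibleChain μ P) (y : Ω) : ∑ x, μ x * P x y = μ y := by
  simp only [h.detailed_balance _ y, ← mul_sum, h.row_sum, mul_one]

theorem dirichlet_eq (h : IsReversibleChain μ P) (f g : Ω → ℝ) :
    1 / 2 * ∑ x, ∑ y, μ x * P x y * ((f x - f y) * (g x - g y)) =
      ∑ x, μ x * (f x * g x) - ∑ x, μ x * (P.mulVec f x * g x) := by
  have e : ∀ x y, μ x * P x y * ((f x - f y) * (g x - g y)) =
      P x y * (μ x * (f x * g x)) + μ x * P x y * (f y * g y) - μ x * (P x y * f y * g x) -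
        μ x * P x y * (f x * g y) := fun x y => by ring
  have e1 : ∑ x, ∑ y, P x y * (μ x * (f x * g x)) = ∑ x, μ x * (f x * g x) := by
    simp only [← sum_mul, h.row_sum, one_mul]
  have e2 : ∑ x, ∑ y, μ x * P x y * (f y * g y) = ∑ x, μ x * (f x * g x) := by
    rw [sum_comm]
    simp only [← sum_mul, h.stationary]
  have e3 : ∑ x, ∑ y, μ x * (P x y * f y * g x) = ∑ x, μ x * (P.mulVec f x * g x) := by
    simp only [← mul_sum, ← sum_mul, Matrix.mulVec, dotProduct]
  have e4 : ∑ x, ∑ y, μ x * P x y * (f x * g y) = ∑ x, μ x * (P.mulVec f x * g x) := by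
    rw [← e3, sum_comm]
    refine sum_congr rfl fun x _ => sum_congr rfl fun y _ => ?_
    rw [h.detailed_balance]
    ring
  simp only [e, sum_sub_distrib, sum_add_distrib, e1, e2, e3, e4]
  ring

/-- By reversibility `ℰ(f, log f) = μ(f log f) - μ(Pf log f)`, and Gibbs' inequality bounds the last
term by `μ(Pf log Pf)`, as `f` and `Pf` have equal means. So the form is at least `Ent(f) -
Ent(Pf)`. If the chain can move between a zero and a nonzero of `f`, the form is `⊤`; otherwise `Pf`
vanishes wherever `f` does, and Gibbs' inequality holds with the convention `Real.log 0 = 0`. -/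
theorem modifiedLogSobolev_of_contraction (h : IsReversibleChain μ P) {κ : ℝ}
    (hκ : ∀ f : Ω → ℝ, (∀ x, 0 ≤ f x) → chainEnt μ (P.mulVec f) ≤ (1 - κ) * chainEnt μ f) :
    ModifiedLogSobolev μ P κ := by
  intro f hf
  have hlogpos : ∀ x, 0 < f x → extLog (f x) = ((Real.log (f x) : ℝ) : EReal) := fun x hx =>
    ENNReal.log_ofReal_of_pos hx
  have hlogzero : ∀ x, f x = 0 → extLog (f x) = ⊥ := fun x hx => by simp [extLog, hx]
  have hmP : ∀ x y, 0 ≤ μ x * P x y := fun x y => mul_nonneg (h.pos x).le (h.nonneg x y)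
  have hboth : ∀ x y, 0 < f x → 0 < f y →
      ((μ x * P x y : ℝ) : EReal) * (((f x - f y : ℝ) : EReal) * (extLog (f x) - extLog (f y))) =
        ((μ x * P x y * ((f x - f y) * (Real.log (f x) - Real.log (f y))) : ℝ) : EReal) := by
    intro x y hx hy
    rw [hlogpos x hx, hlogpos y hy]
    norm_cast
  have hzz : ∀ x y, f x = 0 → f y = 0 →
      ((μ x * P x y : ℝ) : EReal) * (((f x - f y : ℝ) : EReal) * (extLog (f x) - extLog (f y))) =
        0 := by
    intro x y hx hy
    simp [hx, hy]
  have hinner : ∀ x y, (f x = 0 ∧ 0 < f y) ∨ (0 < f x ∧ f y = 0) →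
      ((f x - f y : ℝ) : EReal) * (extLog (f x) - extLog (f y)) = ⊤ := by
    rintro x y (⟨hx, hy⟩ | ⟨hx, hy⟩)
    · rw [hlogzero x hx, hlogpos y hy, EReal.bot_sub]
      exact EReal.coe_mul_bot_of_neg (by linarith)
    · rw [hlogpos x hx, hlogzero y hy, EReal.coe_sub_bot]
      exact EReal.coe_mul_top_of_pos (by linarith)
  have hcases : ∀ x y, (0 < f x ∧ 0 < f y) ∨ (f x = 0 ∧ f y = 0) ∨
      ((f x = 0 ∧ 0 < f y) ∨ (0 < f x ∧ f y = 0)) := by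
    intro x y
    rcases (hf x).eq_or_lt with hx | hx <;> rcases (hf y).eq_or_lt with hy | hy
    · exact Or.inr (Or.inl ⟨hx.symm, hy.symm⟩)
    · exact Or.inr (Or.inr (Or.inl ⟨hx.symm, hy⟩))
    · exact Or.inr (Or.inr (Or.inr ⟨hx, hy.symm⟩))
    · exact Or.inl ⟨hx, hy⟩
  have hmono : ∀ x y, 0 < f x → 0 < f y →
      0 ≤ (f x - f y) * (Real.log (f x) - Real.log (f y)) := by
    intro x y hx hy
    rcases le_total (f x) (f y) with hxy | hxy
    · exact mul_nonneg_of_nonpos_of_nonpos (by linarith)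
        (by linarith [Real.log_le_log hx hxy])
    · exact mul_nonneg (by linarith) (by linarith [Real.log_le_log hy hxy])
  have hterm : ∀ x y, 0 ≤
      ((μ x * P x y : ℝ) : EReal) *
        (((f x - f y : ℝ) : EReal) * (extLog (f x) - extLog (f y))) := by
    intro x y
    rcases hcases x y with ⟨hx, hy⟩ | ⟨hx, hy⟩ | hxy
    · rw [hboth x y hx hy]
      exact EReal.coe_nonneg.mpr (mul_nonneg (hmP x y) (hmono x y hx hy))
    · rw [hzz x y hx hy]
    · rw [hinner x y hxy]
      exact mul_nonneg (EReal.coe_nonneg.mpr (hmP x y)) le_top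
  by_cases hA : ∃ x y, 0 < μ x * P x y ∧ ((f x = 0 ∧ 0 < f y) ∨ (0 < f x ∧ f y = 0))
  · obtain ⟨x, y, hxy, hz⟩ := hA
    have htop : ((μ x * P x y : ℝ) : EReal) *
        (((f x - f y : ℝ) : EReal) * (extLog (f x) - extLog (f y))) = ⊤ := by
      rw [hinner x y hz]
      exact EReal.coe_mul_top_of_pos hxy
    have hsum : ∑ x, ∑ y, ((μ x * P x y : ℝ) : EReal) *
        (((f x - f y : ℝ) : EReal) * (extLog (f x) - extLog (f y))) = ⊤ := by
      refine top_le_iff.mp ?_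
      rw [← htop]
      refine le_trans ?_ (single_le_sum (f := fun x => ∑ y, ((μ x * P x y : ℝ) : EReal) *
        (((f x - f y : ℝ) : EReal) * (extLog (f x) - extLog (f y))))
        (fun x _ => sum_nonneg fun y _ => hterm x y) (mem_univ x))
      exact single_le_sum (f := fun y => ((μ x * P x y : ℝ) : EReal) *
        (((f x - f y : ℝ) : EReal) * (extLog (f x) - extLog (f y))))
        (fun y _ => hterm x y) (mem_univ y)
    unfold dirichletForm
    rw [hsum, EReal.coe_mul_top_of_pos (by norm_num)]
    exact le_top
  · have hzero : ∀ x y, (f x = 0 ∧ 0 < f y) ∨ (0 < f x ∧ f y = 0) → μ x * P x y = 0 := by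
      intro x y hxy
      by_contra hne
      exact hA ⟨x, y, lt_of_le_of_ne (hmP x y) (Ne.symm hne), hxy⟩
    have hreal : ∀ x y, ((μ x * P x y : ℝ) : EReal) *
        (((f x - f y : ℝ) : EReal) * (extLog (f x) - extLog (f y))) =
        ((μ x * P x y * ((f x - f y) * (Real.log (f x) - Real.log (f y))) : ℝ) : EReal) := by
      intro x y
      rcases hcases x y with ⟨hx, hy⟩ | ⟨hx, hy⟩ | hxy
      · exact hboth x y hx hy
      · rw [hzz x y hx hy, hx, hy]
        simp
      · rw [hzero x y hxy]
        simp
    unfold dirichletForm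
    simp only [hreal]
    have hc : ∀ F : Ω → ℝ, ∑ x, ((F x : ℝ) : EReal) = ((∑ x, F x : ℝ) : EReal) := fun F =>
      (map_sum (⟨⟨Real.toEReal, EReal.coe_zero⟩, EReal.coe_add⟩ : ℝ →+ EReal) F univ).symm
    simp only [hc]
    rw [← EReal.coe_mul, EReal.coe_le_coe_iff, h.dirichlet_eq]
    have hPz : ∀ x, f x = 0 → P.mulVec f x = 0 := by
      intro x hx
      refine sum_eq_zero fun y _ => ?_
      rcases (hf y).eq_or_lt with hy | hy
      · rw [← hy, mul_zero]
      · have := hzero x y (Or.inl ⟨hx, hy⟩)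
        exact mul_eq_zero_of_left ((mul_eq_zero.mp this).resolve_left (h.pos x).ne') _
    have hPn : ∀ x, 0 ≤ P.mulVec f x := fun x =>
      sum_nonneg fun y _ => mul_nonneg (h.nonneg x y) (hf y)
    have hgibbs := sum_le_sum fun x (_ : x ∈ univ) => mul_le_mul_of_nonneg_left
      (mul_log_le_mul_log_sub_add (hPn x) (hf x) (hPz x)) (h.pos x).le
    have hmean : ∑ x, μ x * P.mulVec f x = ∑ x, μ x * f x := by
      simp only [Matrix.mulVec, dotProduct, mul_sum]
      rw [sum_comm]
      simp only [← mul_assoc, ← sum_mul, h.stationary]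
    have hκf := hκ f hf
    simp only [mul_add, mul_sub, sum_add_distrib, sum_sub_distrib, hmean] at hgibbs
    unfold chainEnt at hκf ⊢
    rw [hmean] at hκf
    linarith

theorem chainEnt_pow_le [DecidableEq Ω] (h : IsReversibleChain μ P) {κ : ℝ} (hκ1 : κ ≤ 1)
    (hκ : ∀ f : Ω → ℝ, (∀ x, 0 ≤ f x) → chainEnt μ (P.mulVec f) ≤ (1 - κ) * chainEnt μ f)
    (f : Ω → ℝ) (hf : ∀ x, 0 ≤ f x) (t : ℕ) :
    chainEnt μ ((P ^ t).mulVec f) ≤ (1 - κ) ^ t * chainEnt μ f ∧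
      (∀ x, 0 ≤ (P ^ t).mulVec f x) ∧ ∑ x, μ x * (P ^ t).mulVec f x = ∑ x, μ x * f x := by
  induction t with
  | zero => simpa using hf
  | succ t ih =>
    obtain ⟨h1, h2, h3⟩ := ih
    have e : (P ^ (t + 1)).mulVec f = P.mulVec ((P ^ t).mulVec f) := by
      rw [pow_succ', Matrix.mulVec_mulVec]
    rw [e]
    refine ⟨?_, fun x => sum_nonneg fun y _ => mul_nonneg (h.nonneg x y) (h2 y), ?_⟩
    · refine (hκ _ h2).trans ?_
      rw [pow_succ', mul_assoc]
      exact mul_le_mul_of_nonneg_left h1 (by linarith)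
    · rw [← h3]
      generalize (P ^ t).mulVec f = g
      simp only [Matrix.mulVec, dotProduct, mul_sum]
      rw [sum_comm]
      simp only [← mul_assoc, ← sum_mul, h.stationary]

theorem pow_detailed_balance [DecidableEq Ω] (h : IsReversibleChain μ P) (t : ℕ) (x y : Ω) :
    μ x * (P ^ t) x y = μ y * (P ^ t) y x := by
  induction t generalizing x y with
  | zero =>
    by_cases hxy : x = y
    · rw [hxy]
    · simp [Matrix.one_apply_ne hxy, Matrix.one_apply_ne (Ne.symm hxy)]
  | succ t ih =>
    rw [pow_succ]
    nth_rewrite 2 [← pow_succ]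
    rw [pow_succ', Matrix.mul_apply, Matrix.mul_apply, mul_sum, mul_sum]
    refine sum_congr rfl fun z _ => ?_
    rw [← mul_assoc, ih, mul_right_comm, h.detailed_balance]
    ring

/-- Start from the density of the point mass at `x`, whose entropy is `log (1 / μ x)`. By
reversibility `P ^ t` maps it to the density of the law at time `t`, so entropy contraction and
Pinsker's inequality apply. -/
theorem tvDistance_sq_le [DecidableEq Ω] (h : IsReversibleChain μ P) {κ : ℝ} (hκ1 : κ ≤ 1)
    (hκ : ∀ f : Ω → ℝ, (∀ x, 0 ≤ f x) → chainEnt μ (P.mulVec f) ≤ (1 - κ) * chainEnt μ f)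
    (x : Ω) (t : ℕ) :
    2 * tvDistance ((P ^ t) x) μ ^ 2 ≤ (1 - κ) ^ t * Real.log (1 / μ x) := by
  have hx := h.pos x
  set f : Ω → ℝ := Pi.single x (μ x)⁻¹ with hfdef
  have hf : ∀ y, 0 ≤ f y := fun y => by
    by_cases hy : y = x
    · subst hy; simp [hfdef]; exact hx.le
    · simp [hfdef, Pi.single_eq_of_ne hy]
  obtain ⟨h1, h2, h3⟩ := h.chainEnt_pow_le hκ1 hκ f hf t
  have hf1 : ∑ y, μ y * f y = 1 := by
    rw [sum_eq_single x (fun y _ hy => by simp [hfdef, Pi.single_eq_of_ne hy]) (by simp)]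
    simp [hfdef, hx.ne']
  have hent : chainEnt μ f = Real.log (1 / μ x) := by
    unfold chainEnt
    rw [hf1, sum_eq_single x (fun y _ hy => by simp [hfdef, Pi.single_eq_of_ne hy]) (by simp)]
    simp [hfdef, hx.ne']
  have hg : ∀ y, (P ^ t).mulVec f y = (P ^ t) x y / μ y := fun y => by
    rw [eq_div_iff (h.pos y).ne', hfdef, Matrix.mulVec_single]
    simp only [Pi.smul_apply, Matrix.col_apply, MulOpposite.smul_eq_mul_unop,
      MulOpposite.unop_op]
    have := h.pow_detailed_balance t x y
    field_simp
    linarith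
  have hpin := sq_tv_le_chainEnt μ _ (fun y => (h.pos y).le) h.sum_eq_one h2 (h3.trans hf1)
  have e : ∑ y, μ y * |(P ^ t).mulVec f y - 1| = 2 * tvDistance ((P ^ t) x) μ := by
    unfold tvDistance
    rw [← mul_assoc, mul_one_div_cancel two_ne_zero, one_mul]
    refine sum_congr rfl fun y _ => ?_
    have hy := h.pos y
    nth_rewrite 1 [← abs_of_pos hy]
    rw [← abs_mul, hg, mul_sub, mul_one, mul_div_cancel₀ _ hy.ne']
  rw [e] at hpin
  rw [hent] at h1
  linarith

theorem mixingTime_le [DecidableEq Ω] [Nonempty Ω] (h : IsReversibleChain μ P) {κ : ℝ}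
    (hκ0 : 0 < κ) (hκ1 : κ ≤ 1)
    (hκ : ∀ f : Ω → ℝ, (∀ x, 0 ≤ f x) → chainEnt μ (P.mulVec f) ≤ (1 - κ) * chainEnt μ f)
    {ε : ℝ} (hε : 0 < ε) :
    mixingTime μ P ε ≤ (mixingBound κ (⨅ x, μ x) ε : ℕ∞) := by
  set p := ⨅ x, μ x with hp
  have hple : ∀ x, p ≤ μ x := fun x => ciInf_le (Set.finite_range μ).bddBelow x
  have hppos : 0 < p := by
    obtain ⟨x, hx⟩ := exists_eq_ciInf_of_finite (f := μ)
    rw [hp, ← hx]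
    exact h.pos x
  have hμ1 : ∀ x, μ x ≤ 1 := fun x => by
    rw [← h.sum_eq_one]
    exact single_le_sum (fun y _ => (h.pos y).le) (mem_univ x)
  have hlog : ∀ x, Real.log (1 / μ x) ≤ Real.log (1 / p) := fun x =>
    Real.log_le_log (one_div_pos.mpr (h.pos x)) (one_div_le_one_div_of_le hppos (hple x))
  refine iSup_le fun x => iInf₂_le_of_le (mixingBound κ p ε) ?_ le_rfl
  have htv := h.tvDistance_sq_le hκ1 hκ x (mixingBound κ p ε)
  refine le_of_sq_le_sq ?_ hε.le
  by_cases h1 : p = 1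
  · have : Real.log (1 / μ x) ≤ 0 := by simpa [h1] using hlog x
    have : (1 - κ) ^ mixingBound κ p ε * Real.log (1 / μ x) ≤ 0 :=
      mul_nonpos_of_nonneg_of_nonpos (pow_nonneg (by linarith) _) this
    nlinarith
  · have hp1 : p < 1 := lt_of_le_of_ne ((hple x).trans (hμ1 x)) h1
    have hL : 0 < Real.log (1 / p) := Real.log_pos (by rw [lt_div_iff₀ hppos]; linarith)
    set t := mixingBound κ p ε with ht
    -- The natural-number ceiling truncates negative values to `0`, but is still at least its
    -- argument.
    have htge : Real.log (Real.log (1 / p)) + Real.log (1 / (2 * ε ^ 2)) ≤ κ * t := by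
      have := Nat.le_ceil (1 / κ * (Real.log (Real.log (1 / p)) + Real.log (1 / (2 * ε ^ 2))))
      have e : (t : ℝ) =
          ⌈1 / κ * (Real.log (Real.log (1 / p)) + Real.log (1 / (2 * ε ^ 2)))⌉₊ := by
        rw [ht, mixingBound, if_neg h1]
      rw [← e, one_div, inv_mul_le_iff₀ hκ0] at this
      exact this
    have hpow : (1 - κ) ^ t ≤ Real.exp (-(κ * t)) := by
      have := pow_le_pow_left₀ (by linarith) (Real.one_sub_le_exp_neg κ) t
      rwa [← Real.exp_nat_mul, mul_neg, mul_comm (t : ℝ)] at this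
    have hfin : Real.exp (-(κ * t)) * Real.log (1 / p) ≤ 2 * ε ^ 2 := by
      have : Real.exp (-(κ * t)) ≤ 2 * ε ^ 2 / Real.log (1 / p) := by
        rw [← Real.exp_log (by positivity : 0 < 2 * ε ^ 2 / Real.log (1 / p))]
        refine Real.exp_le_exp.mpr ?_
        rw [Real.log_div (by positivity) hL.ne']
        rw [one_div (2 * ε ^ 2), Real.log_inv] at htge
        linarith
      rwa [le_div_iff₀ hL] at this
    have h2 : (1 - κ) ^ t * Real.log (1 / μ x) ≤ Real.exp (-(κ * t)) * Real.log (1 / p) :=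
      (mul_le_mul_of_nonneg_left (hlog x) (pow_nonneg (by linarith) _)).trans
        (mul_le_mul_of_nonneg_right hpow hL.le)
    linarith

end IsReversibleChain

/-! ### Entropy growth from vertices to edges -/

/-- A symmetric probability weight `W` on pairs with first marginal `p`, a symmetric nonnegative
function `F` on pairs, and its conditional expectation `f` given the first coordinate. -/
structure EdgeAverage {V : Type*} [Fintype V] (W F : V → V → ℝ) (p f : V → ℝ) : Prop where
  weight_nonneg : ∀ i j, 0 ≤ W i j
  weight_symm : ∀ i j, W i j = W j i
  marginal : ∀ i, ∑ j, W i j = p i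
  pos : ∀ i, 0 < p i
  sum_eq_one : ∑ i, p i = 1
  nonneg : ∀ i j, 0 ≤ F i j
  symm : ∀ i j, F i j = F j i
  average : ∀ i, ∑ j, W i j * F i j = p i * f i

namespace EdgeAverage

variable {V : Type*} [Fintype V] {W F : V → V → ℝ} {p f : V → ℝ}

theorem avg_nonneg (h : EdgeAverage W F p f) (i : V) : 0 ≤ f i := by
  have : 0 ≤ p i * f i := by
    rw [← h.average]
    exact sum_nonneg fun j _ => mul_nonneg (h.weight_nonneg i j) (h.nonneg i j)
  exact nonneg_of_mul_nonneg_right this (h.pos i)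

theorem sum_fst (h : EdgeAverage W F p f) (g : V → ℝ) :
    ∑ i, ∑ j, W i j * g i = ∑ i, p i * g i := by
  simp only [← sum_mul, h.marginal]

theorem sum_snd (h : EdgeAverage W F p f) (g : V → ℝ) :
    ∑ i, ∑ j, W i j * g j = ∑ i, p i * g i := by
  rw [sum_comm, ← h.sum_fst]
  simp only [h.weight_symm]

theorem sum_mul_fst (h : EdgeAverage W F p f) (g : V → ℝ) :
    ∑ i, ∑ j, W i j * F i j * g i = ∑ i, p i * f i * g i := by
  simp only [← sum_mul, h.average]

theorem sum_mul_snd (h : EdgeAverage W F p f) (g : V → ℝ) :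
    ∑ i, ∑ j, W i j * F i j * g j = ∑ i, p i * f i * g i := by
  rw [sum_comm, ← h.sum_mul_fst]
  refine sum_congr rfl fun i _ => sum_congr rfl fun j _ => ?_
  rw [h.weight_symm, h.symm]

theorem sum_weight (h : EdgeAverage W F p f) : ∑ i, ∑ j, W i j = 1 := by
  simp only [h.marginal, h.sum_eq_one]

theorem sum_weight_mul (h : EdgeAverage W F p f) :
    ∑ i, ∑ j, W i j * F i j = ∑ i, p i * f i := by
  simp only [h.average]

theorem weight_mul_eq_zero (h : EdgeAverage W F p f) {i : V} (hi : f i = 0) (j : V) :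
    W i j * F i j = 0 := by
  have : ∑ j, W i j * F i j = 0 := by rw [h.average, hi, mul_zero]
  exact (sum_eq_zero_iff_of_nonneg fun j _ =>
    mul_nonneg (h.weight_nonneg i j) (h.nonneg i j)).mp this j (mem_univ j)

/-- Spectral bound for not necessarily centred functions. -/
theorem quadratic_le (h : EdgeAverage W F p f) {ζ : ℝ}
    (hgap : ∀ g : V → ℝ, ∑ i, p i * g i = 0 →
      ∑ i, ∑ j, W i j * (g i * g j) ≤ ζ * ∑ i, p i * g i ^ 2) (g : V → ℝ) :
    ∑ i, ∑ j, W i j * (g i * g j) - (∑ i, p i * g i) ^ 2 ≤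
      ζ * (∑ i, p i * g i ^ 2 - (∑ i, p i * g i) ^ 2) := by
  set m := ∑ i, p i * g i with hm
  have h1 := hgap (fun i => g i - m) (by
    simp only [mul_sub, sum_sub_distrib, ← hm]
    rw [← sum_mul, h.sum_eq_one]; ring)
  have e1 : ∀ i j, W i j * ((g i - m) * (g j - m)) =
      W i j * (g i * g j) - m * (W i j * g i) - m * (W i j * g j) + m ^ 2 * W i j :=
    fun i j => by ring
  have e2 : ∀ i, p i * (g i - m) ^ 2 = p i * g i ^ 2 - 2 * m * (p i * g i) + m ^ 2 * p i :=
    fun i => by ring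
  simp only [e1, e2, sum_add_distrib, sum_sub_distrib, ← mul_sum, h.sum_fst, h.sum_snd,
    h.sum_weight, h.sum_eq_one, ← hm] at h1
  nlinarith

/-- Compare `F i j` with the product `f i * f j / E` by Gibbs' inequality. The excess on the right
is at least `Ent(f)` minus `(⟨f, W f⟩ - E²) / E`; the gap bounds this loss by `ζ Var(f) / E`, and `f
≤ K E` bounds `Var(f)` by `4 K² E Ent(f)`. -/
theorem entropy_growth_of_bounded (h : EdgeAverage W F p f) {ζ K : ℝ} (hζ : 0 ≤ ζ)
    (hgap : ∀ g : V → ℝ, ∑ i, p i * g i = 0 →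
      ∑ i, ∑ j, W i j * (g i * g j) ≤ ζ * ∑ i, p i * g i ^ 2)
    (hK : ∀ i, f i ≤ K * ∑ i, p i * f i) :
    (1 - 4 * ζ * K ^ 2) * chainEnt p f ≤
      ∑ i, ∑ j, W i j * (F i j * Real.log (F i j)) - ∑ i, p i * (f i * Real.log (f i)) := by
  set E := ∑ i, p i * f i with hE
  have hE0 : 0 ≤ E := sum_nonneg fun i _ => mul_nonneg (h.pos i).le (h.avg_nonneg i)
  rcases hE0.eq_or_lt with hE0 | hE0
  · have hf0 : ∀ i, f i = 0 := fun i => by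
      have := (sum_eq_zero_iff_of_nonneg fun i _ => mul_nonneg (h.pos i).le (h.avg_nonneg i)).mp
        hE0.symm i (mem_univ i)
      exact (mul_eq_zero.mp this).resolve_left (h.pos i).ne'
    have hF0 : ∀ i j, W i j * (F i j * Real.log (F i j)) = 0 := fun i j => by
      rw [← mul_assoc, h.weight_mul_eq_zero (hf0 i), zero_mul]
    simp [chainEnt, hf0, hF0]
  have hK1 : 1 ≤ K := by
    have : E ≤ K * E := calc
      E = ∑ i, p i * f i := rfl
      _ ≤ ∑ i, p i * (K * E) := sum_le_sum fun i _ =>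
          mul_le_mul_of_nonneg_left (hK i) (h.pos i).le
      _ = K * E := by rw [← sum_mul, h.sum_eq_one, one_mul]
    exact le_of_mul_le_mul_right (by linarith) hE0
  -- the quadratic lower bound for the excess
  have h1 : ∀ i j, W i j * F i j * Real.log (f i) + W i j * F i j * Real.log (f j) -
      W i j * F i j * Real.log E + W i j * F i j - E⁻¹ * (W i j * (f i * f j)) ≤
      W i j * (F i j * Real.log (F i j)) := by
    intro i j
    have hW := h.weight_nonneg i j
    by_cases hz : W i j * F i j = 0
    · have : 0 ≤ E⁻¹ * (W i j * (f i * f j)) := by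
        have := h.avg_nonneg i
        have := h.avg_nonneg j
        positivity
      rw [← mul_assoc (W i j) (F i j), hz]
      linarith
    have hi : 0 < f i := (h.avg_nonneg i).lt_of_ne fun hi =>
      hz (h.weight_mul_eq_zero hi.symm j)
    have hj : 0 < f j := (h.avg_nonneg j).lt_of_ne fun hj => hz (by
      rw [h.weight_symm, h.symm]
      exact h.weight_mul_eq_zero hj.symm i)
    have h2 := mul_log_le_mul_log_sub_add (h.nonneg i j)
      (by positivity : 0 ≤ f i * f j / E) fun h0 => absurd h0 (by positivity)
    rw [Real.log_div (by positivity) hE0.ne', Real.log_mul hi.ne' hj.ne', div_eq_inv_mul] at h2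
    have := mul_le_mul_of_nonneg_left h2 hW
    linarith
  have h2 := sum_le_sum fun i (_ : i ∈ univ) => sum_le_sum fun j (_ : j ∈ univ) => h1 i j
  simp only [sum_add_distrib, sum_sub_distrib, ← mul_sum, h.sum_mul_snd,
    ← sum_mul, h.average, ← hE] at h2
  have hq := h.quadratic_le hgap f
  rw [← hE] at hq
  -- variance versus entropy
  have hv : ∑ i, p i * f i ^ 2 - E ^ 2 ≤ 4 * K ^ 2 * E * chainEnt p f := by
    have h3 : ∀ i, p i * f i ^ 2 - 2 * E * (p i * f i) + E ^ 2 * p i ≤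
        4 * K ^ 2 * E * (p i * (f i * Real.log (f i)) - Real.log E * (p i * f i) - p i * f i
          + E * p i) := by
      intro i
      have hi := h.avg_nonneg i
      have h4 := sq_sub_one_le_of_le (div_nonneg hi hE0.le)
        ((div_le_iff₀ hE0).mpr (hK i)) hK1
      have h5 := mul_le_mul_of_nonneg_left h4 (mul_nonneg (h.pos i).le (sq_nonneg E))
      have e1 : p i * E ^ 2 * (f i / E - 1) ^ 2 =
          p i * f i ^ 2 - 2 * E * (p i * f i) + E ^ 2 * p i := by
        field_simp
        ring
      have e2 : f i / E * Real.log (f i / E) = (f i * Real.log (f i) - f i * Real.log E) / E := by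
        rcases hi.eq_or_lt with h0 | h0
        · simp [← h0]
        · rw [Real.log_div h0.ne' hE0.ne']; ring
      have e3 : p i * E ^ 2 * (4 * K ^ 2 * (f i / E * Real.log (f i / E) - f i / E + 1)) =
          4 * K ^ 2 * E * (p i * (f i * Real.log (f i)) - Real.log E * (p i * f i) - p i * f i
          + E * p i) := by
        rw [e2]
        field_simp
      rw [e1, e3] at h5
      exact h5
    have h4 := sum_le_sum fun i (_ : i ∈ univ) => h3 i
    simp only [← mul_sum, sum_add_distrib, sum_sub_distrib, h.sum_eq_one, ← hE] at h4
    unfold chainEnt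
    rw [← hE]
    nlinarith
  have hvar : E⁻¹ * ∑ i, ∑ j, W i j * (f i * f j) ≤ E + ζ * (4 * K ^ 2) * chainEnt p f := by
    rw [inv_mul_le_iff₀ hE0]
    nlinarith [mul_le_mul_of_nonneg_left hv hζ]
  have hent : chainEnt p f = ∑ i, p i * f i * Real.log (f i) - E * Real.log E := by
    unfold chainEnt
    rw [← hE]
    simp only [mul_assoc]
  have e : ∑ i, p i * (f i * Real.log (f i)) = ∑ i, p i * f i * Real.log (f i) := by
    simp only [mul_assoc]
  rw [e]
  nlinarith

/-- For `g = √F` one chains `Ent(f) ≤ Ent(F) ≤ (2 + L) Var(g)`, then `(1 - ζ)/2 · Var(g) ≤ 𝔼 Var(g |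
i)`, then `Var(g | i) ≤ Ent(g² | i)`. The average of the last quantity is the right-hand side. -/
theorem entropy_growth_of_weight_ge (h : EdgeAverage W F p f) {ζ L : ℝ} (hζ : 0 ≤ ζ)
    (hζ1 : ζ ≤ 1) (hL : 0 ≤ L)
    (hgap : ∀ g : V → ℝ, ∑ i, p i * g i = 0 →
      ∑ i, ∑ j, W i j * (g i * g j) ≤ ζ * ∑ i, p i * g i ^ 2)
    (hirr : ∀ i, W i i = 0)
    (hW : ∀ i j, 0 < W i j → Real.exp (-L) ≤ 2 * W i j) :
    (1 - ζ) / (4 + 2 * L) * chainEnt p f ≤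
      ∑ i, ∑ j, W i j * (F i j * Real.log (F i j)) - ∑ i, p i * (f i * Real.log (f i)) := by
  classical
  set g : V → V → ℝ := fun i j => √(F i j) with hg
  have hg2 : ∀ i j, g i j ^ 2 = F i j := fun i j => Real.sq_sqrt (h.nonneg i j)
  have hgn : ∀ i j, 0 ≤ g i j := fun i j => Real.sqrt_nonneg _
  have hgs : ∀ i j, g i j = g j i := fun i j => by simp only [hg, h.symm]
  set u : V → ℝ := fun i => (p i)⁻¹ * ∑ j, W i j * g i j with hu
  have hpu : ∀ i, ∑ j, W i j * g i j = p i * u i := fun i => by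
    simp only [hu]; rw [mul_inv_cancel_left₀ (h.pos i).ne']
  have hG : EdgeAverage W g p u :=
    { h with nonneg := hgn, symm := hgs, average := hpu }
  set m := ∑ i, p i * u i with hm
  set Q := ∑ i, p i * f i with hQ
  set B := ∑ i, p i * u i ^ 2 with hB
  -- the entropy on pairs is at most `(2 + L)` times the variance
  have hpair : ∑ i, ∑ j, W i j * (F i j * Real.log (F i j)) - Q * Real.log Q ≤
      (2 + L) * (Q - m ^ 2) := by
    have := entropy_sq_le_variance (fun x : V × V => W x.1 x.2) (fun x => g x.1 x.2)
      (fun x => h.weight_nonneg _ _) (by rw [Fintype.sum_prod_type]; exact h.sum_weight)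
      (fun x => hgn _ _) hL (by
        rintro ⟨i, j⟩ hij
        simp only at hij ⊢
        have hne : i ≠ j := by
          rintro rfl
          rw [hirr] at hij
          exact lt_irrefl _ hij
        -- Each edge appears in both orientations, distinct since `W` vanishes on the diagonal. This
        -- doubles the available weight and accounts for the `2` in `hW`.
        have h1 : W i j * g i j ^ 2 + W j i * g j i ^ 2 ≤
            ∑ y : V × V, W y.1 y.2 * g y.1 y.2 ^ 2 := by
          have hne' : (i, j) ≠ (j, i) := fun h => hne (Prod.mk.inj h).1
          have := sum_le_sum_of_subset_of_nonneg (f := fun y : V × V => W y.1 y.2 * g y.1 y.2 ^ 2)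
            (subset_univ ({(i, j), (j, i)} : Finset (V × V)))
            fun y _ _ => mul_nonneg (h.weight_nonneg _ _) (sq_nonneg _)
          rwa [sum_pair hne'] at this
        rw [← h.weight_symm i j, ← hgs i j] at h1
        have h2 := mul_le_mul_of_nonneg_right (hW i j hij) (sq_nonneg (g i j))
        rw [Real.exp_neg, inv_mul_le_iff₀ (Real.exp_pos L)] at h2
        refine h2.trans (mul_le_mul_of_nonneg_left ?_ (Real.exp_pos L).le)
        linarith)
    simp only [Fintype.sum_prod_type, hg2, h.sum_weight_mul, hG.sum_weight_mul] at this
    exact this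
  -- the gap of the walk on pairs
  have hB2 := h.quadratic_le hgap u
  rw [← hm, ← hB] at hB2
  have hQB : (1 - ζ) / 2 * (Q - m ^ 2) ≤ Q - B := by
    -- The value optimizing `0 ≤ Var(g) - 4t V + 2t² (1 + ζ) V`, where `V = B - m²` is the variance
    -- of the conditional mean `u`. The inequality is the nonnegativity of the squared distance from
    -- `g - m` to `t` times the sum of the centred `u i` and `u j`, and it yields `2V ≤ (1 + ζ)
    -- Var(g)`.
    set t := (1 + ζ)⁻¹ with ht
    have ht0 : 0 < t := by positivity
    have htz : t * (1 + ζ) = 1 := inv_mul_cancel₀ (by positivity)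
    have hsq : 0 ≤ ∑ i, ∑ j, W i j * (g i j - m - t * (u i - m + (u j - m))) ^ 2 :=
      sum_nonneg fun i _ => sum_nonneg fun j _ => mul_nonneg (h.weight_nonneg i j) (sq_nonneg _)
    have e : ∀ i j, W i j * (g i j - m - t * (u i - m + (u j - m))) ^ 2 =
        W i j * g i j ^ 2 - 2 * t * (W i j * g i j * u i) - 2 * t * (W i j * g i j * u j)
        + 2 * (2 * t - 1) * m * (W i j * g i j) + t ^ 2 * (W i j * u i ^ 2)
        + t ^ 2 * (W i j * u j ^ 2) + 2 * t ^ 2 * (W i j * (u i * u j))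
        - 2 * t * (2 * t - 1) * m * (W i j * u i) - 2 * t * (2 * t - 1) * m * (W i j * u j)
        + (2 * t - 1) ^ 2 * m ^ 2 * W i j := fun i j => by ring
    have hpu2 : ∑ i, p i * u i * u i = B := sum_congr rfl fun i _ => by ring
    simp only [e, sum_sub_distrib, sum_add_distrib] at hsq
    simp only [← mul_sum] at hsq
    rw [hG.sum_mul_fst, hG.sum_mul_snd, hG.sum_weight_mul, h.sum_fst, h.sum_snd, h.sum_fst, h.sum_snd,
      hpu2, h.sum_weight, ← hm, ← hB] at hsq
    simp only [hg2] at hsq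
    rw [h.sum_weight_mul, ← hQ] at hsq
    set S := ∑ i, ∑ j, W i j * (u i * u j)
    have h3 : 0 ≤ Q - m ^ 2 - 4 * t * (B - m ^ 2) + 2 * t ^ 2 * (B - m ^ 2)
        + 2 * t ^ 2 * (S - m ^ 2) := by nlinarith
    have h4 : 2 * t ^ 2 * (S - m ^ 2) ≤ 2 * t ^ 2 * (ζ * (B - m ^ 2)) :=
      mul_le_mul_of_nonneg_left hB2 (by positivity)
    have h5 : 2 * t ^ 2 * (B - m ^ 2) + 2 * t ^ 2 * (ζ * (B - m ^ 2)) = 2 * t * (B - m ^ 2) := by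
      have : 2 * t ^ 2 * (B - m ^ 2) + 2 * t ^ 2 * (ζ * (B - m ^ 2)) =
        2 * t * (t * (1 + ζ)) * (B - m ^ 2) := by ring
      rw [this, htz, mul_one]
    have h6 : 0 ≤ Q - m ^ 2 - 2 * t * (B - m ^ 2) := by linarith
    have h7 := mul_nonneg h6 (by linarith : 0 ≤ 1 + ζ)
    have h8 : (Q - m ^ 2 - 2 * t * (B - m ^ 2)) * (1 + ζ) =
        (Q - m ^ 2) * (1 + ζ) - 2 * (t * (1 + ζ)) * (B - m ^ 2) := by ring
    rw [h8, htz] at h7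
    linarith
  -- the conditional entropies dominate the conditional variances
  have hcond : Q - B ≤
      ∑ i, ∑ j, W i j * (F i j * Real.log (F i j)) - ∑ i, p i * (f i * Real.log (f i)) := by
    rw [hQ, hB, ← sum_sub_distrib, ← sum_sub_distrib]
    refine sum_le_sum fun i _ => ?_
    have hp := h.pos i
    have := variance_le_entropy_sq (fun j => (p i)⁻¹ * W i j) (g i)
      (fun j => mul_nonneg (inv_nonneg.mpr hp.le) (h.weight_nonneg i j)) (hgn i)
    simp only [hg2, mul_assoc, ← mul_sum, h.average, hpu, inv_mul_cancel_left₀ hp.ne'] at this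
    have := mul_le_mul_of_nonneg_left this hp.le
    rw [mul_sub, mul_sub, mul_inv_cancel_left₀ hp.ne'] at this
    exact this
  -- conclusion
  have hEnt : chainEnt p f ≤
      ∑ i, ∑ j, W i j * (F i j * Real.log (F i j)) - Q * Real.log Q := by
    unfold chainEnt
    rw [← hQ]
    have h0 : 0 ≤ Q - m ^ 2 := by
      have : 0 ≤ ∑ i, ∑ j, W i j * (g i j - m) ^ 2 :=
        sum_nonneg fun i _ => sum_nonneg fun j _ => mul_nonneg (h.weight_nonneg i j) (sq_nonneg _)
      have e : ∀ i j, W i j * (g i j - m) ^ 2 = W i j * F i j - 2 * m * (W i j * g i j)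
        + m ^ 2 * W i j := fun i j => by rw [← hg2]; ring
      simp only [e, sum_sub_distrib, sum_add_distrib] at this
      simp only [← mul_sum] at this
      rw [h.sum_weight_mul, hG.sum_weight_mul, h.sum_weight, ← hm, ← hQ] at this
      linarith
    have : 0 ≤ (1 - ζ) / 2 * (Q - m ^ 2) := mul_nonneg (by linarith) h0
    linarith
  calc (1 - ζ) / (4 + 2 * L) * chainEnt p f
      ≤ (1 - ζ) / (4 + 2 * L) * ((2 + L) * (Q - m ^ 2)) :=
        mul_le_mul_of_nonneg_left (hEnt.trans hpair) (div_nonneg (by linarith) (by linarith))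
    _ = (1 - ζ) / 2 * (Q - m ^ 2) := by
        rw [show 4 + 2 * L = 2 * (2 + L) by ring]
        have : 2 + L ≠ 0 := by linarith
        field_simp
    _ ≤ _ := hQB.trans hcond

end EdgeAverage

/-! ### Masses and conditional expectations on a weighted complex -/

namespace PureWeightedComplex

variable {U : Type*}

theorem mem_level (X : PureWeightedComplex U) {k : ℕ} {σ : Finset U} :
    σ ∈ X.level k ↔ σ ∈ X.faces ∧ #σ = k := mem_filter

theorem card_le_dim (X : PureWeightedComplex U) {τ : Finset U} (hτ : τ ∈ X.faces) :
    #τ ≤ X.dim := by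
  obtain ⟨σ, -, hsub, hσ⟩ := X.pure τ hτ
  exact hσ ▸ card_le_card hsub

theorem exists_superset (X : PureWeightedComplex U) {τ : Finset U} (hτ : τ ∈ X.faces) {k : ℕ}
    (h1 : #τ ≤ k) (h2 : k ≤ X.dim) : ∃ σ ∈ X.level k, τ ⊆ σ := by
  obtain ⟨σ, hσ, hsub, hc⟩ := X.pure τ hτ
  obtain ⟨ρ, hτρ, hρσ, hρ⟩ := exists_subsuperset_card_eq hsub h1 (hc ▸ h2)
  exact ⟨ρ, X.mem_level.mpr ⟨X.down_closed σ hσ ρ hρσ, hρ⟩, hτρ⟩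

theorem level_nonempty (X : PureWeightedComplex U) {k : ℕ} (h : k ≤ X.dim) :
    (X.level k).Nonempty := by
  obtain ⟨σ, hσ, -⟩ := X.exists_superset X.empty_mem (k := k) (by simp) h
  exact ⟨σ, hσ⟩

variable [DecidableEq U]

/-- The total weight of the maximal faces containing `τ`. -/
def mass (X : PureWeightedComplex U) (τ : Finset U) : ℝ :=
  ∑ σ ∈ X.level X.dim with τ ⊆ σ, X.w σ

theorem mass_nonneg (X : PureWeightedComplex U) (τ : Finset U) : 0 ≤ X.mass τ :=
  sum_nonneg fun σ hσ => by
    have := X.mem_level.mp (mem_filter.mp hσ).1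
    exact (X.w_pos σ this.1 this.2).le

theorem mass_pos (X : PureWeightedComplex U) {τ : Finset U} (hτ : τ ∈ X.faces) :
    0 < X.mass τ := by
  obtain ⟨σ, hσ, hsub⟩ := X.exists_superset hτ (X.card_le_dim hτ) le_rfl
  refine sum_pos (fun σ hσ => ?_) ⟨σ, mem_filter.mpr ⟨hσ, hsub⟩⟩
  have := X.mem_level.mp (mem_filter.mp hσ).1
  exact X.w_pos σ this.1 this.2

theorem prob_eq (X : PureWeightedComplex U) (k : ℕ) (τ : Finset U) :
    X.prob k τ = X.mass τ / (X.mass ∅ * (X.dim.choose k : ℝ)) := by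
  simp only [prob, topProb]
  have h0 : ∑ σ ∈ X.level X.dim, X.w σ = X.mass ∅ := by simp [mass]
  rw [h0, ← sum_mul, ← sum_div, div_mul_div_comm, mul_one]
  rfl

theorem prob_nonneg (X : PureWeightedComplex U) (k : ℕ) (τ : Finset U) : 0 ≤ X.prob k τ := by
  rw [prob_eq]
  exact div_nonneg (X.mass_nonneg τ) (mul_nonneg (X.mass_nonneg ∅) (Nat.cast_nonneg _))

theorem prob_pos (X : PureWeightedComplex U) {k : ℕ} {τ : Finset U} (hτ : τ ∈ X.level k) :
    0 < X.prob k τ := by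
  obtain ⟨h1, h2⟩ := X.mem_level.mp hτ
  rw [prob_eq]
  exact div_pos (X.mass_pos h1) (mul_pos (X.mass_pos X.empty_mem)
    (Nat.cast_pos.mpr (Nat.choose_pos (h2 ▸ X.card_le_dim h1))))

theorem mass_eq_zero (X : PureWeightedComplex U) {τ : Finset U} (hτ : τ ∉ X.faces) :
    X.mass τ = 0 := by
  refine sum_eq_zero fun σ hσ => ?_
  obtain ⟨h1, h2⟩ := mem_filter.mp hσ
  exact absurd (X.down_closed σ (X.mem_level.mp h1).1 τ h2) hτ

theorem prob_eq_zero (X : PureWeightedComplex U) (k : ℕ) {τ : Finset U} (hτ : τ ∉ X.faces) :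
    X.prob k τ = 0 := by
  rw [prob_eq, X.mass_eq_zero hτ, zero_div]

/-- Double counting of the flags `τ ⊆ ρ ⊆ σ`. -/
theorem sum_flags (X : PureWeightedComplex U) (τ : Finset U) {j s : ℕ} (hj : #τ ≤ j)
    (G : Finset U → ℝ) :
    ∑ ρ ∈ X.level j with τ ⊆ ρ, ∑ σ ∈ X.level s with ρ ⊆ σ, G σ =
      ((s - #τ).choose (j - #τ) : ℝ) * ∑ σ ∈ X.level s with τ ⊆ σ, G σ := by
  have h1 : ∑ ρ ∈ X.level j with τ ⊆ ρ, ∑ σ ∈ X.level s with ρ ⊆ σ, G σ =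
      ∑ σ ∈ X.level s with τ ⊆ σ, ∑ ρ ∈ X.level j with τ ⊆ ρ ∧ ρ ⊆ σ, G σ := by
    refine sum_comm' fun ρ σ => ?_
    simp only [mem_filter]
    constructor
    · rintro ⟨⟨a, b⟩, c, d⟩
      exact ⟨⟨a, b, d⟩, c, b.trans d⟩
    · rintro ⟨⟨a, b, d⟩, c, -⟩
      exact ⟨⟨a, b⟩, c, d⟩
  rw [h1, mul_sum]
  refine sum_congr rfl fun σ hσ => ?_
  obtain ⟨hσ, hτσ⟩ := mem_filter.mp hσ
  obtain ⟨hσf, hσs⟩ := X.mem_level.mp hσ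
  rw [sum_const, nsmul_eq_mul]
  congr 2
  rw [← hσs, ← card_sdiff_of_subset hτσ, ← card_powersetCard]
  refine card_bij' (fun ρ _ => ρ \ τ) (fun ξ _ => τ ∪ ξ) ?_ ?_ ?_ ?_
  · intro ρ hρ
    obtain ⟨hρ, h2, h3⟩ := mem_filter.mp hρ
    rw [mem_powersetCard, card_sdiff_of_subset h2, (X.mem_level.mp hρ).2]
    exact ⟨sdiff_subset_sdiff h3 Subset.rfl, rfl⟩
  · intro ξ hξ
    obtain ⟨h2, h3⟩ := mem_powersetCard.mp hξ
    obtain ⟨h4, h5⟩ := subset_sdiff.mp h2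
    refine mem_filter.mpr ⟨X.mem_level.mpr ⟨X.down_closed σ hσf _ (union_subset hτσ h4), ?_⟩,
      subset_union_left, union_subset hτσ h4⟩
    rw [card_union_of_disjoint h5.symm, h3]
    omega
  · intro ρ hρ
    exact union_sdiff_of_subset (mem_filter.mp hρ).2.1
  · intro ξ hξ
    exact union_sdiff_cancel_left (subset_sdiff.mp (mem_powersetCard.mp hξ).1).2.symm

theorem sum_mass (X : PureWeightedComplex U) (τ : Finset U) {j : ℕ} (hj : #τ ≤ j) :
    ∑ ρ ∈ X.level j with τ ⊆ ρ, X.mass ρ =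
      ((X.dim - #τ).choose (j - #τ) : ℝ) * X.mass τ :=
  X.sum_flags τ hj X.w

/-! #### Links -/

theorem mem_link_level (X : PureWeightedComplex U) {τ : Finset U} (hτ : τ ∈ X.faces) {j : ℕ}
    {ξ : Finset U} :
    ξ ∈ (X.link τ hτ).level j ↔ Disjoint τ ξ ∧ τ ∪ ξ ∈ X.faces ∧ #ξ = j := by
  rw [mem_level, mem_link_faces, and_assoc]

theorem sum_link_level (X : PureWeightedComplex U) {τ : Finset U} (hτ : τ ∈ X.faces) (j : ℕ)
    (G : Finset U → ℝ) :
    ∑ ξ ∈ (X.link τ hτ).level j, G (τ ∪ ξ) = ∑ ρ ∈ X.level (#τ + j) with τ ⊆ ρ, G ρ := by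
  refine sum_bij' (fun ξ _ => τ ∪ ξ) (fun ρ _ => ρ \ τ) ?_ ?_ ?_ ?_ fun _ _ => rfl
  · intro ξ hξ
    obtain ⟨h1, h2, h3⟩ := (X.mem_link_level hτ).mp hξ
    refine mem_filter.mpr ⟨X.mem_level.mpr ⟨h2, ?_⟩, subset_union_left⟩
    rw [card_union_of_disjoint h1, h3]
  · intro ρ hρ
    obtain ⟨h1, h2⟩ := mem_filter.mp hρ
    obtain ⟨h3, h4⟩ := X.mem_level.mp h1
    refine (X.mem_link_level hτ).mpr ⟨disjoint_sdiff, ?_, ?_⟩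
    · rwa [union_sdiff_of_subset h2]
    · rw [card_sdiff_of_subset h2]
      omega
  · intro ξ hξ
    exact union_sdiff_cancel_left ((X.mem_link_level hτ).mp hξ).1
  · intro ρ hρ
    exact union_sdiff_of_subset (mem_filter.mp hρ).2

/-- Maximal faces of the link are maximal faces through `τ` with the same weights. All link
distributions are therefore ratios of masses in `X` itself, which avoids iterated links. -/
theorem link_mass (X : PureWeightedComplex U) {τ : Finset U} (hτ : τ ∈ X.faces)
    {η : Finset U} (hη : Disjoint τ η) : (X.link τ hτ).mass η = X.mass (τ ∪ η) := by
  have h1 := X.sum_link_level hτ (X.link τ hτ).dim (fun ρ => if τ ∪ η ⊆ ρ then X.w ρ else 0)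
  have h2 : #τ + (X.link τ hτ).dim = X.dim := Nat.add_sub_cancel' (X.card_le_dim hτ)
  rw [h2] at h1
  have h3 : (X.link τ hτ).mass η = ∑ ξ ∈ (X.link τ hτ).level (X.link τ hτ).dim,
      if τ ∪ η ⊆ τ ∪ ξ then X.w (τ ∪ ξ) else 0 := by
    rw [mass, sum_filter]
    refine sum_congr rfl fun ξ hξ => ?_
    have e : η ⊆ ξ ↔ τ ∪ η ⊆ τ ∪ ξ := by
      refine ⟨fun h => union_subset_union_right h, fun h x hx => ?_⟩
      rcases mem_union.mp (h (mem_union_right τ hx)) with h4 | h4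
      · exact absurd hx (disjoint_left.mp hη h4)
      · exact h4
    simp only [← e]
    rfl
  rw [h3, h1, mass, ← sum_filter, filter_filter]
  congr 1
  ext ρ
  simp only [mem_filter, and_congr_right_iff, and_iff_right_iff_imp]
  exact fun _ h => subset_union_left.trans h

theorem link_prob_eq (X : PureWeightedComplex U) {τ : Finset U} (hτ : τ ∈ X.faces) (j : ℕ)
    {η : Finset U} (hη : Disjoint τ η) :
    (X.link τ hτ).prob j η = X.mass (τ ∪ η) / (X.mass τ * ((X.dim - #τ).choose j : ℝ)) := by
  rw [prob_eq, X.link_mass hτ hη, X.link_mass hτ (disjoint_empty_right τ), union_empty]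
  rfl

/-! #### Conditional expectations -/

/-- The conditional expectation of `f`, a function on `𝔛(s)`, given that the random face
contains `τ`. -/
def condExp (X : PureWeightedComplex U) (s : ℕ) (f : Finset U → ℝ) (τ : Finset U) : ℝ :=
  (∑ σ ∈ X.level s with τ ⊆ σ, X.mass σ * f σ) /
    (X.mass τ * ((X.dim - #τ).choose (s - #τ) : ℝ))

theorem condExp_nonneg (X : PureWeightedComplex U) (s : ℕ) {f : Finset U → ℝ}
    (hf : ∀ σ, 0 ≤ f σ) (τ : Finset U) : 0 ≤ X.condExp s f τ :=
  div_nonneg (sum_nonneg fun σ _ => mul_nonneg (X.mass_nonneg σ) (hf σ))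
    (mul_nonneg (X.mass_nonneg τ) (Nat.cast_nonneg _))

theorem condExp_congr (X : PureWeightedComplex U) {s : ℕ} {f g : Finset U → ℝ}
    (h : ∀ σ ∈ X.level s, f σ = g σ) (τ : Finset U) : X.condExp s f τ = X.condExp s g τ := by
  unfold condExp
  congr 1
  exact sum_congr rfl fun σ hσ => by rw [h σ (mem_filter.mp hσ).1]

theorem condExp_mono (X : PureWeightedComplex U) {s : ℕ} {f g : Finset U → ℝ}
    (h : ∀ σ ∈ X.level s, f σ ≤ g σ) (τ : Finset U) : X.condExp s f τ ≤ X.condExp s g τ := by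
  refine div_le_div_of_nonneg_right (sum_le_sum fun σ hσ => ?_)
    (mul_nonneg (X.mass_nonneg τ) (Nat.cast_nonneg _))
  exact mul_le_mul_of_nonneg_left (h σ (mem_filter.mp hσ).1) (X.mass_nonneg σ)

theorem condExp_sub (X : PureWeightedComplex U) (s : ℕ) (f g : Finset U → ℝ) (τ : Finset U) :
    X.condExp s (fun σ => f σ - g σ) τ = X.condExp s f τ - X.condExp s g τ := by
  simp only [condExp, mul_sub, sum_sub_distrib, sub_div]

theorem condExp_const_mul (X : PureWeightedComplex U) (s : ℕ) (a : ℝ) (f : Finset U → ℝ)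
    (τ : Finset U) : X.condExp s (fun σ => a * f σ) τ = a * X.condExp s f τ := by
  simp only [condExp, mul_left_comm _ a, ← mul_sum, mul_div_assoc]

theorem condExp_self (X : PureWeightedComplex U) {s : ℕ} (f : Finset U → ℝ) {τ : Finset U}
    (hτ : τ ∈ X.level s) : X.condExp s f τ = f τ := by
  obtain ⟨h1, h2⟩ := X.mem_level.mp hτ
  have h3 : ∑ σ ∈ X.level s with τ ⊆ σ, X.mass σ * f σ = X.mass τ * f τ := by
    refine sum_eq_single_of_mem τ (mem_filter.mpr ⟨hτ, Subset.rfl⟩) fun ρ hρ hne => ?_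
    obtain ⟨hρ, hsub⟩ := mem_filter.mp hρ
    refine absurd (eq_of_subset_of_card_le hsub ?_).symm hne
    rw [(X.mem_level.mp hρ).2, h2]
  rw [condExp, h3, h2, Nat.sub_self, Nat.choose_zero_right, Nat.cast_one, mul_one,
    mul_div_cancel_left₀ _ (X.mass_pos h1).ne']

theorem condExp_one (X : PureWeightedComplex U) {s : ℕ} {τ : Finset U} (hτ : τ ∈ X.faces)
    (h1 : #τ ≤ s) (h2 : s ≤ X.dim) : X.condExp s (fun _ => 1) τ = 1 := by
  have h3 : 0 < ((X.dim - #τ).choose (s - #τ) : ℝ) :=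
    Nat.cast_pos.mpr (Nat.choose_pos (by omega))
  have := X.mass_pos hτ
  simp only [condExp, mul_one]
  rw [X.sum_mass τ h1, mul_comm, div_self (by positivity)]

/-- Counting flags `τ ⊆ ρ ⊆ σ` shows that each `σ` is weighted by the same number of intermediate
`ρ`; the normalizations then match by the identity for products of binomial coefficients. -/
theorem condExp_tower (X : PureWeightedComplex U) {j s : ℕ} (f : Finset U → ℝ) {τ : Finset U}
    (hτ : τ ∈ X.faces) (h1 : #τ ≤ j) (h2 : j ≤ s) (h3 : s ≤ X.dim) :
    X.condExp j (X.condExp s f) τ = X.condExp s f τ := by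
  have hc1 : 0 < ((X.dim - #τ).choose (s - #τ) : ℝ) :=
    Nat.cast_pos.mpr (Nat.choose_pos (by omega))
  have hc2 : 0 < ((X.dim - #τ).choose (j - #τ) : ℝ) :=
    Nat.cast_pos.mpr (Nat.choose_pos (by omega))
  have hc3 : 0 < ((X.dim - j).choose (s - j) : ℝ) :=
    Nat.cast_pos.mpr (Nat.choose_pos (by omega))
  have hm := X.mass_pos hτ
  have e1 : ∀ ρ ∈ (X.level j).filter (τ ⊆ ·), X.mass ρ * X.condExp s f ρ =
      ((X.dim - j).choose (s - j) : ℝ)⁻¹ * ∑ σ ∈ X.level s with ρ ⊆ σ, X.mass σ * f σ := by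
    intro ρ hρ
    obtain ⟨h4, h5⟩ := X.mem_level.mp (mem_filter.mp hρ).1
    have := X.mass_pos h4
    rw [condExp, h5]
    field_simp
  have e2 : ((X.dim - #τ).choose (s - #τ) : ℝ) * ((s - #τ).choose (j - #τ) : ℝ) =
      ((X.dim - #τ).choose (j - #τ) : ℝ) * ((X.dim - j).choose (s - j) : ℝ) := by
    have := Nat.choose_mul (n := X.dim - #τ) (k := s - #τ) (s := j - #τ) (by omega)
    rw [show X.dim - #τ - (j - #τ) = X.dim - j by omega,
      show s - #τ - (j - #τ) = s - j by omega] at this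
    exact_mod_cast this
  rw [condExp, sum_congr rfl e1, ← mul_sum, X.sum_flags τ h1, condExp]
  rw [div_eq_div_iff (by positivity) (by positivity)]
  field_simp
  linear_combination (∑ σ ∈ X.level s with τ ⊆ σ, X.mass σ * f σ) * e2

theorem sum_link_prob (X : PureWeightedComplex U) {τ : Finset U} (hτ : τ ∈ X.faces) (j : ℕ)
    (f : Finset U → ℝ) :
    ∑ ξ ∈ (X.link τ hτ).level j, (X.link τ hτ).prob j ξ * f (τ ∪ ξ) =
      X.condExp (#τ + j) f τ := by
  rw [condExp, sum_div, ← X.sum_link_level hτ j fun ρ => X.mass ρ * f ρ /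
    (X.mass τ * ((X.dim - #τ).choose (#τ + j - #τ) : ℝ))]
  refine sum_congr rfl fun ξ hξ => ?_
  rw [X.link_prob_eq hτ j ((X.mem_link_level hτ).mp hξ).1, Nat.add_sub_cancel_left]
  ring

theorem sum_prob (X : PureWeightedComplex U) (k : ℕ) (f : Finset U → ℝ) :
    ∑ τ ∈ X.level k, X.prob k τ * f τ = X.condExp k f ∅ := by
  rw [condExp, sum_div]
  simp only [empty_subset, filter_true, card_empty, Nat.sub_zero]
  refine sum_congr rfl fun τ _ => ?_
  rw [prob_eq]
  ring

/-- Bound for the conditional expectation given one more element. -/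
theorem condExp_union_le (X : PureWeightedComplex U) {s : ℕ} {f : Finset U → ℝ}
    (hf : ∀ σ, 0 ≤ f σ) {τ : Finset U} (hτ : τ ∈ X.faces) (h1 : #τ < s) (h2 : s ≤ X.dim)
    {i : Finset U} (hi : i ∈ (X.link τ hτ).level 1) :
    (X.link τ hτ).prob 1 i * ((s : ℝ) - #τ) * X.condExp s f (τ ∪ i) ≤ X.condExp s f τ := by
  obtain ⟨hd, hm, hc⟩ := (X.mem_link_level hτ).mp hi
  have hcard : #(τ ∪ i) = #τ + 1 := by rw [card_union_of_disjoint hd, hc]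
  have m1 := X.mass_pos hτ
  have m2 := X.mass_pos hm
  obtain ⟨a, ha⟩ : ∃ a, s = #τ + 1 + a := ⟨s - (#τ + 1), by omega⟩
  obtain ⟨c, hcn⟩ : ∃ c, X.dim = #τ + 1 + c := ⟨X.dim - (#τ + 1), by omega⟩
  have c0 : 0 < (c.choose a : ℝ) := Nat.cast_pos.mpr (Nat.choose_pos (by omega))
  have c1 : 0 < ((c + 1).choose (a + 1) : ℝ) := Nat.cast_pos.mpr (Nat.choose_pos (by omega))
  have hchoose : ((c : ℝ) + 1) * (c.choose a : ℝ) = ((c + 1).choose (a + 1) : ℝ) * (a + 1) := by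
    exact_mod_cast Nat.add_one_mul_choose_eq c a
  have hsum : ∑ σ ∈ X.level s with τ ∪ i ⊆ σ, X.mass σ * f σ ≤
      ∑ σ ∈ X.level s with τ ⊆ σ, X.mass σ * f σ := by
    refine sum_le_sum_of_subset_of_nonneg (fun σ hσ => ?_) fun σ _ _ =>
      mul_nonneg (X.mass_nonneg σ) (hf σ)
    obtain ⟨h3, h4⟩ := mem_filter.mp hσ
    exact mem_filter.mpr ⟨h3, subset_union_left.trans h4⟩
  have hs : ((s : ℝ) - #τ) = a + 1 := by rw [ha]; push_cast; ring
  rw [X.link_prob_eq hτ 1 hd, condExp, condExp, hcard, hs]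
  rw [show X.dim - #τ = c + 1 by omega, show X.dim - (#τ + 1) = c by omega,
    show s - (#τ + 1) = a by omega, show s - #τ = a + 1 by omega, Nat.choose_one_right]
  set A := ∑ σ ∈ X.level s with τ ∪ i ⊆ σ, X.mass σ * f σ
  -- The left side is the conditional expectation given `τ` of `f` restricted to faces containing
  -- `i`: such faces have conditional probability `(s - #τ) π_{τ,1}(i)`.
  have e : X.mass (τ ∪ i) / (X.mass τ * ((c + 1 : ℕ) : ℝ)) * ((a : ℝ) + 1) *
      (A / (X.mass (τ ∪ i) * (c.choose a : ℝ))) =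
      A / (X.mass τ * ((c + 1).choose (a + 1) : ℝ)) := by
    push_cast
    rw [eq_div_iff (by positivity)]
    field_simp
    linear_combination -A * hchoose
  rw [e]
  exact div_le_div_of_nonneg_right hsum (by positivity)

end PureWeightedComplex

/-! ### The second eigenvalue of a reversible chain -/

/-- At most one eigenvalue exceeds the second one, with multiplicity. For fewer than two entries the
count is at most one whatever the default value. -/
theorem card_filter_gt_sort_getD_le (M : Multiset ℝ) :
    (M.filter ((M.sort (· ≥ ·)).getD 1 0 < ·)).card ≤ 1 := by
  set l := M.sort (· ≥ ·) with hl
  have hM : M = (l : Multiset ℝ) := (Multiset.sort_eq _ _).symm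
  have hs : l.Pairwise (· ≥ ·) := Multiset.pairwise_sort _ _
  rw [hM, Multiset.filter_coe, Multiset.coe_card]
  match l, hs with
  | [], _ => simp
  | [a], _ => exact List.length_filter_le _ _
  | a :: b :: t, hs =>
    have ht : List.filter (fun x => decide (b < x)) (b :: t) = [] := by
      rw [List.filter_eq_nil_iff]
      intro x hx
      have hx' : x ≤ b := by
        rcases List.mem_cons.mp hx with rfl | h
        · exact le_rfl
        · exact List.rel_of_pairwise_cons (List.pairwise_cons.mp hs).2 h
      simpa using hx'
    simp only [List.getD_cons_succ, List.getD_cons_zero]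
    rw [List.filter_cons, ht]
    split <;> simp

namespace IsReversibleChain

variable {Ω : Type*} [Fintype Ω] {μ : Ω → ℝ} {P : Matrix Ω Ω ℝ}

theorem sum_mul_le (h : IsReversibleChain μ P) (g : Ω → ℝ) :
    ∑ x, ∑ y, μ x * P x y * (g x * g y) ≤ ∑ x, μ x * g x ^ 2 := by
  have h1 := h.dirichlet_eq g g
  have h2 : 0 ≤ 1 / 2 * ∑ x, ∑ y, μ x * P x y * ((g x - g y) * (g x - g y)) :=
    mul_nonneg (by norm_num) (sum_nonneg fun x _ => sum_nonneg fun y _ =>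
      mul_nonneg (mul_nonneg (h.pos x).le (h.nonneg x y)) (mul_self_nonneg _))
  have e : ∑ x, ∑ y, μ x * P x y * (g x * g y) = ∑ x, μ x * (P.mulVec g x * g x) := by
    refine sum_congr rfl fun x _ => ?_
    simp only [Matrix.mulVec, dotProduct, sum_mul, mul_sum]
    exact sum_congr rfl fun y _ => by ring
  simp only [← sq] at h1
  simp only [← sq] at h2
  rw [e]
  linarith

variable [DecidableEq Ω]

/-- The matrix `D^{1/2} P D^{-1/2}` with `D = diag μ`. -/
def symmetrization (μ : Ω → ℝ) (P : Matrix Ω Ω ℝ) : Matrix Ω Ω ℝ :=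
  Matrix.diagonal (fun x => √(μ x)) * P * Matrix.diagonal (fun x => (√(μ x))⁻¹)

theorem symmetrization_apply (x y : Ω) :
    symmetrization μ P x y = √(μ x) * P x y * (√(μ y))⁻¹ := by
  simp [symmetrization, Matrix.mul_diagonal, Matrix.diagonal_mul]

theorem symmetrization_isHermitian (h : IsReversibleChain μ P) :
    (symmetrization μ P).IsHermitian := by
  ext x y
  rw [Matrix.conjTranspose_apply, star_trivial, symmetrization_apply, symmetrization_apply]
  have hx := Real.sqrt_pos.mpr (h.pos x)
  have hy := Real.sqrt_pos.mpr (h.pos y)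
  have hx2 := Real.sq_sqrt (h.pos x).le
  have hy2 := Real.sq_sqrt (h.pos y).le
  have := h.detailed_balance x y
  rw [← hx2, ← hy2] at this
  field_simp
  linarith

theorem charpoly_symmetrization (h : IsReversibleChain μ P) :
    (symmetrization μ P).charpoly = P.charpoly := by
  have h1 : Matrix.diagonal (fun x => (√(μ x))⁻¹) * Matrix.diagonal (fun x => √(μ x)) = 1 := by
    rw [Matrix.diagonal_mul_diagonal, ← Matrix.diagonal_one]
    congr 1
    ext x
    exact inv_mul_cancel₀ (Real.sqrt_pos.mpr (h.pos x)).ne'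
  rw [symmetrization, Matrix.mul_assoc, Matrix.charpoly_mul_comm, Matrix.mul_assoc, h1,
    Matrix.mul_one]

/-- The symmetrization fixes `√μ`. If `ζ < 1`, at most one vector of the eigenbasis has eigenvalue
above `ζ`, and `√μ` is orthogonal to all the others, their eigenvalues differing from `1`. So if
such a vector exists, it is parallel to `√μ`, and `√μ g`, orthogonal to `√μ`, has no component along
it. -/
theorem sum_mul_le_secondEigenvalue (h : IsReversibleChain μ P) {ζ : ℝ} (hζ1 : ζ ≤ 1)
    (hζ : secondEigenvalue P ≤ ζ) (g : Ω → ℝ) (hg : ∑ x, μ x * g x = 0) :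
    ∑ x, ∑ y, μ x * P x y * (g x * g y) ≤ ζ * ∑ x, μ x * g x ^ 2 := by
  -- For `ζ = 1` the eigenvalue `1` is not separated, but nonnegativity of the Dirichlet form
  -- suffices.
  rcases hζ1.eq_or_lt with rfl | hζ1
  · rw [one_mul]
    exact h.sum_mul_le g
  have hH := h.symmetrization_isHermitian
  set S := symmetrization μ P with hS
  set e := hH.eigenvectorBasis with he
  have hcard : (univ.filter fun i => ζ < hH.eigenvalues i).card ≤ 1 := by
    have h1 : P.charpoly.roots = univ.val.map hH.eigenvalues := by
      rw [← h.charpoly_symmetrization, hH.roots_charpoly_eq_eigenvalues]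
      simp
    have h2 := card_filter_gt_sort_getD_le P.charpoly.roots
    change (P.charpoly.roots.filter (secondEigenvalue P < ·)).card ≤ 1 at h2
    refine le_trans ?_ h2
    rw [h1, Multiset.filter_map, Multiset.card_map, card_def]
    refine Multiset.card_le_card ?_
    exact Multiset.monotone_filter_right _ fun i hi => lt_of_le_of_lt hζ hi
  -- the vectors `√μ g` and `√μ`
  set v : EuclideanSpace ℝ Ω := WithLp.toLp 2 fun x => √(μ x) * g x with hv
  set u : EuclideanSpace ℝ Ω := WithLp.toLp 2 fun x => √(μ x) with hu
  have hsq : ∀ x, √(μ x) * √(μ x) = μ x := fun x => Real.mul_self_sqrt (h.pos x).le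
  have hpos : ∀ x, 0 < √(μ x) := fun x => Real.sqrt_pos.mpr (h.pos x)
  have huv : inner ℝ u v = 0 := by
    rw [PiLp.inner_apply, ← hg]
    refine sum_congr rfl fun x _ => ?_
    simp only [hu, hv, RCLike.inner_apply, conj_trivial]
    linear_combination g x * hsq x
  have hSu : S.mulVec u.ofLp = u.ofLp := by
    ext x
    have : ∀ y, S x y * u.ofLp y = √(μ x) * P x y := fun y => by
      rw [hS, symmetrization_apply]
      simp only [hu]
      rw [inv_mul_cancel_right₀ (hpos y).ne']
    refine (sum_congr rfl fun y _ => this y).trans ?_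
    rw [← mul_sum, h.row_sum, mul_one]
  have hcoord : ∀ (z : EuclideanSpace ℝ Ω) (i : Ω),
      inner ℝ (e i) (WithLp.toLp 2 (S.mulVec z.ofLp)) = hH.eigenvalues i * inner ℝ (e i) z := by
    intro z i
    have h1 := hH.mulVec_eigenvectorBasis i
    have h2 : ∀ w z : EuclideanSpace ℝ Ω, inner ℝ w (WithLp.toLp 2 (S.mulVec z.ofLp)) =
        inner ℝ (WithLp.toLp 2 (S.mulVec w.ofLp)) z := by
      intro w z
      have hT : S.transpose = S := by
        have := hH.eq
        rwa [Matrix.conjTranspose_eq_transpose_of_trivial] at this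
      simp only [EuclideanSpace.inner_eq_star_dotProduct, star_trivial]
      rw [Matrix.dotProduct_mulVec, ← Matrix.mulVec_transpose, hT, dotProduct_comm,
        dotProduct_comm]
    rw [h2, h1]
    rw [WithLp.toLp_smul]
    simp [inner_smul_left, he]
  have hquad : ∑ x, ∑ y, μ x * P x y * (g x * g y) =
      ∑ i, hH.eigenvalues i * inner ℝ (e i) v ^ 2 := by
    have h1 : ∑ x, ∑ y, μ x * P x y * (g x * g y) =
        inner ℝ v (WithLp.toLp 2 (S.mulVec v.ofLp)) := by
      rw [PiLp.inner_apply]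
      refine sum_congr rfl fun x _ => ?_
      simp only [RCLike.inner_apply, conj_trivial, Matrix.mulVec, dotProduct, sum_mul]
      refine sum_congr rfl fun y _ => ?_
      rw [hS, symmetrization_apply]
      simp only [hv]
      have h9 : (√(μ y))⁻¹ * √(μ y) = 1 := inv_mul_cancel₀ (hpos y).ne'
      linear_combination -(P x y * g x * g y * ((√(μ y))⁻¹ * √(μ y))) * hsq x -
        μ x * P x y * g x * g y * h9
    rw [h1, ← e.sum_inner_mul_inner]
    refine sum_congr rfl fun i _ => ?_
    rw [hcoord, real_inner_comm]
    ring
  have hnorm : ∑ x, μ x * g x ^ 2 = ∑ i, inner ℝ (e i) v ^ 2 := by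
    have h1 : ∑ x, μ x * g x ^ 2 = inner ℝ v v := by
      rw [PiLp.inner_apply]
      refine sum_congr rfl fun x _ => ?_
      simp only [RCLike.inner_apply, conj_trivial, hv]
      linear_combination -g x ^ 2 * hsq x
    rw [h1, ← e.sum_inner_mul_inner]
    refine sum_congr rfl fun i _ => ?_
    rw [real_inner_comm]
    ring
  have hterm : ∀ i, hH.eigenvalues i * inner ℝ (e i) v ^ 2 ≤ ζ * inner ℝ (e i) v ^ 2 := by
    intro i
    rcases le_or_gt (hH.eigenvalues i) ζ with hi | hi
    · exact mul_le_mul_of_nonneg_right hi (sq_nonneg _)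
    · -- `u` is a multiple of the top eigenvector
      have hother : ∀ j, j ≠ i → inner ℝ (e j) u = 0 := by
        intro j hj
        have hjζ : hH.eigenvalues j ≤ ζ := by
          by_contra! hlt
          exact hj (card_le_one.mp hcard j (by simp [hlt]) i (by simp [hi]))
        have := hcoord u j
        rw [hSu] at this
        have h2 : (1 - hH.eigenvalues j) * inner ℝ (e j) u = 0 := by
          rw [sub_mul, one_mul, ← this]; simp
        exact (mul_eq_zero.mp h2).resolve_left (by linarith)
      have h3 : inner ℝ u u = inner ℝ (e i) u ^ 2 := by
        rw [← e.sum_inner_mul_inner, sum_eq_single i (fun j _ hj => by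
          rw [hother j hj, mul_zero]) (by simp), real_inner_comm, sq]
      have h4 : inner ℝ u v = inner ℝ (e i) u * inner ℝ (e i) v := by
        rw [← e.sum_inner_mul_inner, sum_eq_single i (fun j _ hj => by
          rw [real_inner_comm, hother j hj, zero_mul]) (by simp), real_inner_comm]
      have h5 : inner ℝ u u = (1 : ℝ) := by
        rw [PiLp.inner_apply, ← h.sum_eq_one]
        refine sum_congr rfl fun x _ => ?_
        simp only [RCLike.inner_apply, conj_trivial, hu]
        exact hsq x
      rw [huv] at h4
      have h6 : inner ℝ (e i) v = (0 : ℝ) := by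
        refine (mul_eq_zero.mp h4.symm).resolve_left fun h0 => ?_
        rw [h5, h0] at h3
        norm_num at h3
      rw [h6]
      simp
  rw [hquad, hnorm, mul_sum]
  exact sum_le_sum fun i _ => hterm i

end IsReversibleChain

/-! ### Two-step chains -/

/-- A pair of Markov kernels that are adjoint with respect to `μ` and `ν`. -/
structure IsAdjointPair {Ω Ω' : Type*} [Fintype Ω] [Fintype Ω'] (μ : Ω → ℝ) (ν : Ω' → ℝ)
    (D : Matrix Ω Ω' ℝ) (U : Matrix Ω' Ω ℝ) : Prop where
  pos : ∀ x, 0 < μ x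
  sum_eq_one : ∑ x, μ x = 1
  nonneg : ∀ x y, 0 ≤ D x y
  row_sum : ∀ x, ∑ y, D x y = 1
  pos' : ∀ y, 0 < ν y
  sum_eq_one' : ∑ y, ν y = 1
  nonneg' : ∀ y x, 0 ≤ U y x
  row_sum' : ∀ y, ∑ x, U y x = 1
  balance : ∀ x y, μ x * D x y = ν y * U y x

namespace IsAdjointPair

variable {Ω Ω' : Type*} [Fintype Ω] [Fintype Ω'] {μ : Ω → ℝ} {ν : Ω' → ℝ}
  {D : Matrix Ω Ω' ℝ} {U : Matrix Ω' Ω ℝ}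

theorem swap (h : IsAdjointPair μ ν D U) : IsAdjointPair ν μ U D where
  pos := h.pos'
  sum_eq_one := h.sum_eq_one'
  nonneg := h.nonneg'
  row_sum := h.row_sum'
  pos' := h.pos
  sum_eq_one' := h.sum_eq_one
  nonneg' := h.nonneg
  row_sum' := h.row_sum
  balance := fun y x => (h.balance x y).symm

theorem isReversibleChain (h : IsAdjointPair μ ν D U) : IsReversibleChain μ (D * U) where
  pos := h.pos
  sum_eq_one := h.sum_eq_one
  nonneg := fun x z => by
    rw [Matrix.mul_apply]
    exact sum_nonneg fun y _ => mul_nonneg (h.nonneg x y) (h.nonneg' y z)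
  row_sum := fun x => by
    simp only [Matrix.mul_apply]
    rw [sum_comm]
    simp only [← mul_sum, h.row_sum', mul_one, h.row_sum]
  detailed_balance := fun x z => by
    rw [Matrix.mul_apply, Matrix.mul_apply, mul_sum, mul_sum]
    refine sum_congr rfl fun y _ => ?_
    rw [← mul_assoc, ← mul_assoc, h.balance, h.balance]
    ring

theorem chainEnt_le (h : IsAdjointPair μ ν D U) {g : Ω' → ℝ} (hg : ∀ y, 0 ≤ g y) :
    chainEnt μ (D.mulVec g) ≤ chainEnt ν g := by
  refine chainEnt_mulVec_le μ ν D (fun x => (h.pos x).le) h.nonneg h.row_sum (fun y => ?_) g hg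
  simp only [h.balance, ← mul_sum, h.row_sum', mul_one]

theorem contraction (h : IsAdjointPair μ ν D U) {c : ℝ}
    (hc : ∀ f : Ω → ℝ, (∀ x, 0 ≤ f x) → chainEnt ν (U.mulVec f) ≤ c * chainEnt μ f)
    {f : Ω → ℝ} (hf : ∀ x, 0 ≤ f x) : chainEnt μ ((D * U).mulVec f) ≤ c * chainEnt μ f := by
  rw [← Matrix.mulVec_mulVec]
  exact (h.chainEnt_le fun y => sum_nonneg fun x _ => mul_nonneg (h.nonneg' y x) (hf x)).trans
    (hc f hf)

/-- Here the averaging by `D` comes before the contracting kernel, so its entropy bound gets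
multiplied by `c`; hence the sign condition. -/
theorem contraction_swap (h : IsAdjointPair μ ν D U) {c : ℝ} (hc0 : 0 ≤ c)
    (hc : ∀ f : Ω → ℝ, (∀ x, 0 ≤ f x) → chainEnt ν (U.mulVec f) ≤ c * chainEnt μ f)
    {g : Ω' → ℝ} (hg : ∀ y, 0 ≤ g y) : chainEnt ν ((U * D).mulVec g) ≤ c * chainEnt ν g := by
  rw [← Matrix.mulVec_mulVec]
  exact (hc _ fun x => sum_nonneg fun y _ => mul_nonneg (h.nonneg x y) (hg y)).trans
    (mul_le_mul_of_nonneg_left (h.chainEnt_le hg) hc0)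

end IsAdjointPair

/-! ### Increments with geometric growth -/

/-- The ratio `Δ k / Γ k` is nondecreasing, written in the cross-multiplied form `hcross` because
`Γ` may vanish. Summing over `k < r ≤ l < s` compares the head with the tail; `Γ 0 = 1` keeps the
denominator positive. -/
theorem sum_range_le_of_growth (Δ α : ℕ → ℝ) {r s : ℕ} (hrs : r < s)
    (hα : ∀ k, k + 2 ≤ s → 0 ≤ α k)
    (hg : ∀ k, k + 2 ≤ s → α k * Δ k ≤ Δ (k + 1)) :
    ∑ k ∈ range r, Δ k ≤ (1 - (∑ k ∈ Ico r s, ∏ j ∈ range k, α j) /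
      ∑ k ∈ range s, ∏ j ∈ range k, α j) * ∑ k ∈ range s, Δ k := by
  set Γ : ℕ → ℝ := fun k => ∏ j ∈ range k, α j with hΓ
  have hΓ0 : ∀ k, k < s → 0 ≤ Γ k := fun k hk =>
    prod_nonneg fun j hj => hα j (by have := mem_range.mp hj; omega)
  have hpos : 0 < ∑ k ∈ range s, Γ k := by
    refine sum_pos' (fun k hk => hΓ0 k (mem_range.mp hk)) ⟨0, mem_range.mpr (by omega), ?_⟩
    simp [hΓ]
  have hcross : ∀ k l, k ≤ l → l < s → Δ k * Γ l ≤ Γ k * Δ l := by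
    intro k l hkl
    induction l, hkl using Nat.le_induction with
    | base => intro _; rw [mul_comm]
    | succ l hkl ih =>
      intro hl
      have h1 := mul_le_mul_of_nonneg_right (ih (by omega)) (hα l (by omega))
      have h2 := mul_le_mul_of_nonneg_left (hg l (by omega)) (hΓ0 k (by omega))
      have h3 : Γ (l + 1) = Γ l * α l := prod_range_succ _ _
      rw [h3]
      linarith
  have hsum : (∑ k ∈ range r, Δ k) * ∑ l ∈ Ico r s, Γ l ≤
      (∑ k ∈ range r, Γ k) * ∑ l ∈ Ico r s, Δ l := by
    rw [sum_mul_sum, sum_mul_sum]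
    refine sum_le_sum fun k hk => sum_le_sum fun l hl => ?_
    have := mem_range.mp hk
    obtain ⟨h1, h2⟩ := mem_Ico.mp hl
    exact hcross k l (by omega) h2
  have e1 := sum_range_add_sum_Ico Γ hrs.le
  have e2 := sum_range_add_sum_Ico Δ hrs.le
  have e3 : 1 - (∑ k ∈ Ico r s, Γ k) / ∑ k ∈ range s, Γ k =
      (∑ k ∈ range r, Γ k) / ∑ k ∈ range s, Γ k := by
    rw [eq_div_iff hpos.ne', sub_mul, div_mul_cancel₀ _ hpos.ne']
    linarith
  rw [e3, div_mul_eq_mul_div, le_div_iff₀ hpos, ← e1, ← e2]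
  linarith

namespace PureWeightedComplex

variable {U : Type*} [DecidableEq U]

/-! ### The down and up kernels -/

theorem sum_dist (X : PureWeightedComplex U) {k : ℕ} (hk : k ≤ X.dim) :
    ∑ τ, X.dist k τ = 1 := by
  have := X.sum_prob k fun _ => 1
  rw [X.condExp_one X.empty_mem (by simp) hk] at this
  simp only [mul_one] at this
  exact (sum_coe_sort (X.level k) (X.prob k)).trans this

/-- Extension by zero of a function on `𝔛(s)`. -/
def extend (X : PureWeightedComplex U) (s : ℕ) (f : X.level s → ℝ) (σ : Finset U) : ℝ :=
  if h : σ ∈ X.level s then f ⟨σ, h⟩ else 0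

theorem extend_coe (X : PureWeightedComplex U) {s : ℕ} (f : X.level s → ℝ) (σ : X.level s) :
    X.extend s f σ.1 = f σ := by
  simp [extend]

theorem extend_nonneg (X : PureWeightedComplex U) {s : ℕ} {f : X.level s → ℝ}
    (hf : ∀ σ, 0 ≤ f σ) (σ : Finset U) : 0 ≤ X.extend s f σ := by
  unfold extend
  split
  · exact hf _
  · exact le_rfl

theorem upKernel_apply (X : PureWeightedComplex U) (r s : ℕ) (τ : X.level r) (σ : X.level s) :
    X.upKernel r s τ σ = if τ.1 ⊆ σ.1 then
      X.mass σ.1 / (X.mass τ.1 * ((X.dim - r).choose (s - r) : ℝ)) else 0 := by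
  unfold upKernel
  split_ifs with h
  · rw [X.link_prob_eq _ _ disjoint_sdiff, union_sdiff_of_subset h, (X.mem_level.mp τ.2).2]
  · rfl

theorem upKernel_mulVec (X : PureWeightedComplex U) (r s : ℕ) (f : X.level s → ℝ)
    (τ : X.level r) : (X.upKernel r s).mulVec f τ = X.condExp s (X.extend s f) τ.1 := by
  set G : Finset U → ℝ := fun σ => if τ.1 ⊆ σ then
    X.mass σ * X.extend s f σ / (X.mass τ.1 * ((X.dim - r).choose (s - r) : ℝ)) else 0 with hG
  have h1 : (X.upKernel r s).mulVec f τ = ∑ σ : X.level s, G σ.1 := by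
    refine sum_congr rfl fun σ _ => ?_
    change X.upKernel r s τ σ * f σ = _
    simp only [upKernel_apply, hG, X.extend_coe, ite_mul, zero_mul, div_mul_eq_mul_div]
  rw [h1, sum_coe_sort (X.level s) G, ← sum_filter, ← sum_div, condExp, (X.mem_level.mp τ.2).2]

/-- Both sides of `balance` are the joint law of a random `s`-face and a uniform `r`-subset of it,
sampled in either order. -/
theorem isAdjointPair (X : PureWeightedComplex U) {r s : ℕ} (hrs : r ≤ s) (hs : s ≤ X.dim) :
    IsAdjointPair (X.dist s) (X.dist r) (X.downKernel s r) (X.upKernel r s) where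
  pos := fun σ => X.prob_pos σ.2
  sum_eq_one := X.sum_dist hs
  nonneg := fun σ τ => by
    unfold downKernel
    split_ifs
    · positivity
    · exact le_rfl
  row_sum := fun σ => by
    obtain ⟨h1, h2⟩ := X.mem_level.mp σ.2
    have h3 : (X.level r).filter (· ⊆ σ.1) = powersetCard r σ.1 := by
      ext τ
      rw [mem_filter, mem_level, mem_powersetCard]
      exact ⟨fun h => ⟨h.2, h.1.2⟩, fun h => ⟨⟨X.down_closed _ h1 _ h.1, h.2⟩, h.1⟩⟩
    have h4 : 0 < (s.choose r : ℝ) := Nat.cast_pos.mpr (Nat.choose_pos hrs)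
    unfold downKernel
    rw [sum_coe_sort (X.level r) fun τ : Finset U => if τ ⊆ σ.1 then 1 / (s.choose r : ℝ) else 0,
      ← sum_filter, h3, sum_const, card_powersetCard, h2, nsmul_eq_mul,
      mul_one_div_cancel h4.ne']
  pos' := fun τ => X.prob_pos τ.2
  sum_eq_one' := X.sum_dist (hrs.trans hs)
  nonneg' := fun τ σ => by
    rw [upKernel_apply]
    split_ifs
    · exact div_nonneg (X.mass_nonneg _) (mul_nonneg (X.mass_nonneg _) (Nat.cast_nonneg _))
    · exact le_rfl
  row_sum' := fun τ => by
    obtain ⟨h1, h2⟩ := X.mem_level.mp τ.2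
    have h3 := X.upKernel_mulVec r s (fun _ => 1) τ
    rw [X.condExp_congr (g := fun _ => 1) (fun σ hσ => X.extend_coe _ ⟨σ, hσ⟩),
      X.condExp_one h1 (by omega) hs] at h3
    rw [← h3]
    simp only [Matrix.mulVec, dotProduct, mul_one]
  balance := fun σ τ => by
    rw [upKernel_apply]
    unfold downKernel dist
    split_ifs with h
    · rw [prob_eq, prob_eq]
      have m0 := X.mass_pos X.empty_mem
      have m1 := X.mass_pos (X.mem_level.mp τ.2).1
      have c1 : 0 < (X.dim.choose s : ℝ) := Nat.cast_pos.mpr (Nat.choose_pos hs)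
      have c2 : 0 < (X.dim.choose r : ℝ) := Nat.cast_pos.mpr (Nat.choose_pos (hrs.trans hs))
      have c3 : 0 < (s.choose r : ℝ) := Nat.cast_pos.mpr (Nat.choose_pos hrs)
      have c4 : 0 < ((X.dim - r).choose (s - r) : ℝ) :=
        Nat.cast_pos.mpr (Nat.choose_pos (by omega))
      have hc : (X.dim.choose s : ℝ) * (s.choose r : ℝ) =
          (X.dim.choose r : ℝ) * ((X.dim - r).choose (s - r) : ℝ) := by
        exact_mod_cast Nat.choose_mul (n := X.dim) (k := s) (s := r) hrs
      rw [div_mul_div_comm, div_mul_div_comm, div_eq_div_iff (by positivity) (by positivity)]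
      linear_combination -(X.mass σ.1 * X.mass τ.1 * X.mass ∅) * hc
    · simp

/-! ### Local walks -/

/-- Rows of the local walk are indexed by the vertices of the link of `τ`, while the law lives on
the link of `τ ∪ i`; the extra entries vanish. -/
theorem sum_localWalk (X : PureWeightedComplex U) {τ : Finset U} (hτ : τ ∈ X.faces)
    (i : (X.link τ hτ).level 1) (G : Finset U → ℝ) :
    ∑ j, X.localWalk τ hτ i j * G (τ ∪ i.1 ∪ j.1) = X.condExp (#τ + 2) G (τ ∪ i.1) := by
  have hm := X.union_mem_faces τ hτ i
  obtain ⟨hd, -, hc⟩ := (X.mem_link_level hτ).mp i.2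
  have hcard : #(τ ∪ i.1) + 1 = #τ + 2 := by rw [card_union_of_disjoint hd, hc]
  rw [← hcard, ← X.sum_link_prob hm 1 G]
  unfold localWalk
  rw [sum_coe_sort ((X.link τ hτ).level 1)
    fun j : Finset U => (X.link (τ ∪ i.1) hm).prob 1 j * G (τ ∪ i.1 ∪ j)]
  symm
  refine sum_subset (fun j hj => ?_) fun j hj hj' => ?_
  · obtain ⟨h1, h2, h3⟩ := (X.mem_link_level hm).mp hj
    refine (X.mem_link_level hτ).mpr ⟨h1.mono_left subset_union_left,
      X.down_closed _ h2 _ ?_, h3⟩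
    exact union_subset_union_left subset_union_left
  · have : j ∉ (X.link (τ ∪ i.1) hm).faces := fun h =>
      hj' (mem_filter.mpr ⟨h, ((X.mem_link_level hτ).mp hj).2.2⟩)
    rw [prob_eq_zero _ _ this, zero_mul]

theorem localWalk_self (X : PureWeightedComplex U) {τ : Finset U} (hτ : τ ∈ X.faces)
    (i : (X.link τ hτ).level 1) : X.localWalk τ hτ i i = 0 := by
  refine prob_eq_zero _ _ fun h => ?_
  have h1 := ((X.mem_link_faces _ _ _).mp h).1
  have h2 := ((X.mem_link_level hτ).mp i.2).2.2
  have h3 := h1.mono_left (subset_union_right (s₁ := τ) (s₂ := i.1))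
  rw [disjoint_self.mp h3] at h2
  simp at h2

/-- Stationary weight times transition probability is proportional to the mass of `τ ∪ i ∪ j`, which
is symmetric. -/
theorem localWalk_isReversibleChain (X : PureWeightedComplex U) {τ : Finset U}
    (hτ : τ ∈ X.faces) (hdim : #τ + 2 ≤ X.dim) :
    IsReversibleChain (fun i : (X.link τ hτ).level 1 => (X.link τ hτ).prob 1 i.1)
      (X.localWalk τ hτ) where
  pos := fun i => (X.link τ hτ).prob_pos i.2
  sum_eq_one := by
    have h1 := X.sum_link_prob hτ 1 fun _ => 1
    rw [X.condExp_one hτ (by omega) (by omega)] at h1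
    simp only [mul_one] at h1
    exact (sum_coe_sort _ ((X.link τ hτ).prob 1)).trans h1
  nonneg := fun i j => prob_nonneg _ _ _
  row_sum := fun i => by
    have h1 := X.sum_localWalk hτ i fun _ => 1
    obtain ⟨hd, -, hc⟩ := (X.mem_link_level hτ).mp i.2
    rw [X.condExp_one (X.union_mem_faces τ hτ i)
      (by rw [card_union_of_disjoint hd, hc]; omega) hdim] at h1
    simpa only [mul_one] using h1
  detailed_balance := fun i j => by
    by_cases hij : i = j
    · rw [hij]
    obtain ⟨hdi, hmi, hci⟩ := (X.mem_link_level hτ).mp i.2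
    obtain ⟨hdj, hmj, hcj⟩ := (X.mem_link_level hτ).mp j.2
    have hd : Disjoint i.1 j.1 := by
      obtain ⟨a, ha⟩ := card_eq_one.mp hci
      obtain ⟨c, hc⟩ := card_eq_one.mp hcj
      rw [ha, hc, disjoint_singleton]
      rintro rfl
      exact hij (Subtype.ext (ha.trans hc.symm))
    unfold localWalk
    rw [X.link_prob_eq hτ 1 hdi, X.link_prob_eq hτ 1 hdj,
      X.link_prob_eq _ 1 (disjoint_union_left.mpr ⟨hdj, hd⟩),
      X.link_prob_eq _ 1 (disjoint_union_left.mpr ⟨hdi, hd.symm⟩),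
      card_union_of_disjoint hdi, card_union_of_disjoint hdj, hci, hcj,
      union_right_comm τ j.1 i.1]
    have := X.mass_pos hmi
    have := X.mass_pos hmj
    field_simp

/-! ### Entropy growth along the levels -/

/-- The probability that a random maximal face through `τ` contains `i` is `(n - k) π_{τ,1}(i)`, so
it suffices to exhibit one vertex of one link. -/
theorem mul_le_one_of_marginallyBounded (X : PureWeightedComplex U) {b : ℕ → ℝ}
    (hbdd : X.MarginallyBounded b) {k : ℕ} (hk : k < X.dim) : b k * ((X.dim : ℝ) - k) ≤ 1 := by
  obtain ⟨τ, hτ⟩ := X.level_nonempty hk.le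
  obtain ⟨hτ, hc⟩ := X.mem_level.mp hτ
  obtain ⟨ρ, hρ, hsub⟩ := X.exists_superset hτ (k := k + 1) (by omega) hk
  obtain ⟨hρ, hρc⟩ := X.mem_level.mp hρ
  have hi : ρ \ τ ∈ (X.link τ hτ).level 1 := (X.mem_link_level hτ).mpr
    ⟨disjoint_sdiff, by rwa [union_sdiff_of_subset hsub], by
      rw [card_sdiff_of_subset hsub]; omega⟩
  have h1 := X.condExp_union_le (s := X.dim) (f := fun _ => 1) (fun _ => zero_le_one) hτ
    (by omega) le_rfl hi
  rw [X.condExp_one hτ (by omega) le_rfl, X.condExp_one (by rwa [union_sdiff_of_subset hsub])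
    (by rw [union_sdiff_of_subset hsub]; omega) le_rfl, mul_one, hc] at h1
  have h2 := hbdd τ hτ (by omega) _ hi
  rw [hc] at h2
  have h3 : (k : ℝ) < X.dim := by exact_mod_cast hk
  exact (mul_le_mul_of_nonneg_right h2 (by linarith)).trans h1

theorem two_mul_mul_le_one (X : PureWeightedComplex U) {b : ℕ → ℝ}
    (hb : ∀ k, k < X.dim → 0 < b k) (hbdd : X.MarginallyBounded b) {k : ℕ}
    (hk : k + 2 ≤ X.dim) : 0 < 2 * b k * b (k + 1) ∧ 2 * b k * b (k + 1) ≤ 1 := by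
  have h1 := X.mul_le_one_of_marginallyBounded hbdd (k := k) (by omega)
  have h2 := X.mul_le_one_of_marginallyBounded hbdd (k := k + 1) (by omega)
  have b1 := hb k (by omega)
  have b2 := hb (k + 1) (by omega)
  have h3 : (k : ℝ) + 2 ≤ X.dim := by exact_mod_cast hk
  push_cast at h2
  have h4 : b (k + 1) ≤ 1 := by nlinarith
  have h5 : 2 * b k ≤ 1 := by nlinarith
  exact ⟨by positivity, by nlinarith⟩

theorem log_marginal_nonneg (X : PureWeightedComplex U) {b : ℕ → ℝ}
    (hb : ∀ k, k < X.dim → 0 < b k) (hbdd : X.MarginallyBounded b) {k : ℕ}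
    (hk : k + 2 ≤ X.dim) : 0 ≤ Real.log (1 / (2 * b k * b (k + 1))) := by
  obtain ⟨h1, h2⟩ := X.two_mul_mul_le_one hb hbdd hk
  refine Real.log_nonneg ?_
  rwa [le_div_iff₀ h1, one_mul]

/-- The first term of the maximum can be negative; the second never is, since its logarithm is
nonnegative. -/
theorem alphaConst_nonneg (X : PureWeightedComplex U) {b ζ : ℕ → ℝ}
    (hb : ∀ k, k < X.dim → 0 < b k) (hζ : ∀ k, k + 2 ≤ X.dim → 0 ≤ ζ k ∧ ζ k ≤ 1)
    (hbdd : X.MarginallyBounded b) {s k : ℕ} (hk : k + 2 ≤ X.dim) : 0 ≤ alphaConst b ζ s k := by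
  have h1 := X.log_marginal_nonneg hb hbdd hk
  have h2 := (hζ k hk).2
  exact le_max_of_le_right (div_nonneg (by linarith) (by linarith))

/-- In the link of `τ`, `p i * P i j` is the law of an ordered random edge, and by the tower
property `F` on vertices is the average of `F` on edges. The two growth bounds for such edge
averages give the two terms of `alphaConst`. -/
theorem local_entropy_growth (X : PureWeightedComplex U) {b ζ : ℕ → ℝ}
    (hb : ∀ k, k < X.dim → 0 < b k) (hζ : ∀ k, k + 2 ≤ X.dim → 0 ≤ ζ k ∧ ζ k ≤ 1)
    (hbdd : X.MarginallyBounded b) (hexp : X.LocalSpectralExpander ζ) {s : ℕ} (hs : s ≤ X.dim)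
    {f : Finset U → ℝ} (hf : ∀ σ, 0 ≤ f σ) {τ : Finset U} (hτ : τ ∈ X.faces) (hτs : #τ + 2 ≤ s) :
    alphaConst b ζ s #τ * (X.condExp (#τ + 1)
      (fun ρ => X.condExp s f ρ * Real.log (X.condExp s f ρ)) τ -
        X.condExp s f τ * Real.log (X.condExp s f τ)) ≤
      X.condExp (#τ + 2) (fun ρ => X.condExp s f ρ * Real.log (X.condExp s f ρ)) τ -
      X.condExp (#τ + 1) (fun ρ => X.condExp s f ρ * Real.log (X.condExp s f ρ)) τ := by
  set k := #τ with hk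
  have hdim : k + 2 ≤ X.dim := hτs.trans hs
  set F := X.condExp s f with hF
  set Φ : Finset U → ℝ := fun ρ => F ρ * Real.log (F ρ) with hΦ
  set p : (X.link τ hτ).level 1 → ℝ := fun i => (X.link τ hτ).prob 1 i.1 with hp
  set P := X.localWalk τ hτ with hP
  have hrev : IsReversibleChain p P := X.localWalk_isReversibleChain hτ hdim
  have hFn : ∀ ρ, 0 ≤ F ρ := X.condExp_nonneg s hf
  have hmean : ∀ G : Finset U → ℝ, ∑ i, p i * G (τ ∪ i.1) = X.condExp (k + 1) G τ := fun G => by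
    rw [← X.sum_link_prob hτ 1 G]
    exact sum_coe_sort _ fun i => (X.link τ hτ).prob 1 i * G (τ ∪ i)
  have hpair : ∀ G : Finset U → ℝ, ∑ i, ∑ j, p i * P i j * G (τ ∪ i.1 ∪ j.1) =
      X.condExp (k + 2) G τ := fun G => by
    simp only [mul_assoc, ← mul_sum]
    rw [← X.condExp_tower G hτ (Nat.le_succ k) (Nat.le_succ (k + 1)) hdim, ← hmean]
    exact sum_congr rfl fun i _ => by rw [X.sum_localWalk hτ i G]
  have hedge : EdgeAverage (fun i j => p i * P i j) (fun i j => F (τ ∪ i.1 ∪ j.1)) p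
      (fun i => F (τ ∪ i.1)) :=
    { weight_nonneg := fun i j => mul_nonneg (hrev.pos i).le (hrev.nonneg i j)
      weight_symm := hrev.detailed_balance
      marginal := fun i => by rw [← mul_sum, hrev.row_sum, mul_one]
      pos := hrev.pos
      sum_eq_one := hrev.sum_eq_one
      nonneg := fun i j => hFn _
      symm := fun i j => by rw [union_right_comm]
      average := fun i => by
        have hc : #(τ ∪ i.1) = k + 1 := by
          obtain ⟨h1, -, h2⟩ := (X.mem_link_level hτ).mp i.2
          rw [card_union_of_disjoint h1, h2]
        simp only [mul_assoc, ← mul_sum]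
        rw [X.sum_localWalk hτ i F, X.condExp_tower f (X.union_mem_faces τ hτ i)
          (by omega) (by omega) hs] }
  have hgap := fun g hg => hrev.sum_mul_le_secondEigenvalue (hζ k hdim).2 (hexp τ hτ hdim) g hg
  have hEnt : chainEnt p (fun i => F (τ ∪ i.1)) = X.condExp (k + 1) Φ τ - Φ τ := by
    unfold chainEnt
    rw [hmean F, hmean Φ, X.condExp_tower f hτ (by omega) (by omega) hs]
  have hkdim : k < X.dim := by omega
  have hbk := hb k hkdim
  have hsk : 0 < (s : ℝ) - k := by
    have : (k : ℝ) + 2 ≤ s := by exact_mod_cast hτs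
    linarith
  -- The cap `K` is the inverse of the least possible conditional probability `b_k (s - k)` that the
  -- random `s`-face contains a given vertex.
  have bound1 := hedge.entropy_growth_of_bounded (hζ k hdim).1 hgap
    (K := 1 / (b k * ((s : ℝ) - k))) fun i => by
      rw [hmean F, X.condExp_tower f hτ (by omega) (by omega) hs, one_div,
        le_inv_mul_iff₀ (by positivity)]
      refine le_trans ?_ (X.condExp_union_le hf hτ (by omega) hs i.2)
      exact mul_le_mul_of_nonneg_right
        (mul_le_mul_of_nonneg_right (hbdd τ hτ hkdim _ i.2) hsk.le) (hFn _)
  have hL := X.log_marginal_nonneg hb hbdd hdim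
  have hbb := (X.two_mul_mul_le_one hb hbdd hdim).1
  have bound2 := hedge.entropy_growth_of_weight_ge (hζ k hdim).1 (hζ k hdim).2 hL hgap
    (fun i => by rw [hP, X.localWalk_self hτ i, mul_zero]) fun i j hij => by
      -- With this `L` one has `exp (-L) = 2 b_k b_{k+1}`, and an edge of positive weight has weight
      -- at least `b_k b_{k+1}`: one marginal bound at `τ`, one at `τ ∪ i`.
      rw [← Real.log_inv, one_div, inv_inv, Real.exp_log hbb, mul_assoc]
      have hm := X.union_mem_faces τ hτ i
      have hc : #(τ ∪ i.1) = k + 1 := by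
        obtain ⟨h1, -, h2⟩ := (X.mem_link_level hτ).mp i.2
        rw [card_union_of_disjoint h1, h2]
      have hj : j.1 ∈ (X.link (τ ∪ i.1) hm).level 1 := by
        refine mem_filter.mpr ⟨?_, ((X.mem_link_level hτ).mp j.2).2.2⟩
        by_contra h
        have : P i j = 0 := prob_eq_zero _ _ h
        rw [this, mul_zero] at hij
        exact lt_irrefl _ hij
      have h1 := hbdd τ hτ hkdim _ i.2
      have h2 := hbdd _ hm (by omega) _ hj
      rw [hc] at h2
      exact mul_le_mul_of_nonneg_left (mul_le_mul h1 h2 (hb (k + 1) (by omega)).le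
        (hrev.pos i).le) zero_le_two
  rw [hEnt, hpair Φ, hmean Φ] at bound1 bound2
  rcases max_choice (1 - 4 * ζ k / (b k ^ 2 * ((s : ℝ) - (k : ℝ)) ^ 2))
    ((1 - ζ k) / (4 + 2 * Real.log (1 / (2 * b k * b (k + 1))))) with h | h
  · rw [alphaConst, h]
    refine le_trans (le_of_eq ?_) bound1
    congr 2
    rw [div_pow, one_pow, mul_pow, mul_one_div]
  · rw [alphaConst, h]
    exact bound2

/-- Telescoping writes both entropies as sums of increments `H (k + 1) - H k`, which grow at rate
`alphaConst` by averaging the local inequality over `𝔛(k)`. -/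
theorem chainEnt_upKernel_le (X : PureWeightedComplex U) {b ζ : ℕ → ℝ}
    (hb : ∀ k, k < X.dim → 0 < b k) (hζ : ∀ k, k + 2 ≤ X.dim → 0 ≤ ζ k ∧ ζ k ≤ 1)
    (hbdd : X.MarginallyBounded b) (hexp : X.LocalSpectralExpander ζ) {r s : ℕ} (hrs : r < s)
    (hs : s ≤ X.dim) (f : X.level s → ℝ) (hf : ∀ σ, 0 ≤ f σ) :
    chainEnt (X.dist r) ((X.upKernel r s).mulVec f) ≤
      (1 - kappaConst b ζ r s) * chainEnt (X.dist s) f := by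
  set f' := X.extend s f with hf'
  have hfn : ∀ σ, 0 ≤ f' σ := X.extend_nonneg hf
  set F := X.condExp s f' with hF
  set Φ : Finset U → ℝ := fun ρ => F ρ * Real.log (F ρ) with hΦ
  set H : ℕ → ℝ := fun k => X.condExp k Φ ∅ with hH
  have hH0 : H 0 = Φ ∅ := X.condExp_self Φ (X.mem_level.mpr ⟨X.empty_mem, card_empty⟩)
  have hsum : ∀ k ≤ s, chainEnt (X.dist k) (fun τ => F τ.1) = H k - H 0 := by
    intro k hk
    unfold chainEnt dist
    rw [sum_coe_sort (X.level k) fun τ : Finset U => X.prob k τ * F τ,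
      sum_coe_sort (X.level k) fun τ : Finset U => X.prob k τ * (F τ * Real.log (F τ)),
      X.sum_prob k F, X.sum_prob k Φ, X.condExp_tower f' X.empty_mem (by simp) hk hs, hH0]
  have hr : (X.upKernel r s).mulVec f = fun τ => F τ.1 := funext fun τ => X.upKernel_mulVec r s f τ
  have hs' : f = fun σ : X.level s => F σ.1 := funext fun σ => by
    rw [hF, X.condExp_self f' σ.2, hf', X.extend_coe]
  rw [hr, hsum r hrs.le]
  have hs'' : chainEnt (X.dist s) f = H s - H 0 := by rw [hs', hsum s le_rfl]
  rw [hs'', ← sum_range_sub H r, ← sum_range_sub H s]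
  have htower : ∀ k j, k ≤ j → j ≤ s → X.condExp k (X.condExp j Φ) ∅ = H j := fun k j h1 h2 =>
    X.condExp_tower Φ X.empty_mem (by simp) h1 (h2.trans hs)
  refine sum_range_le_of_growth (fun k => H (k + 1) - H k) (alphaConst b ζ s) hrs ?_ ?_
  · intro k hk
    exact X.alphaConst_nonneg hb hζ hbdd (hk.trans hs)
  · intro k hk
    -- Levels `k + 1` and `k + 2` are rewritten as averages over `τ ∈ 𝔛(k)` of their conditional
    -- expectations, so the inequality can be checked for each `τ`.
    rw [← htower k (k + 1) (by omega) (by omega), ← htower k (k + 1 + 1) (by omega) hk,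
      ← X.condExp_sub, ← X.condExp_sub, ← X.condExp_const_mul]
    refine X.condExp_mono (fun τ hτ => ?_) ∅
    obtain ⟨h1, h2⟩ := X.mem_level.mp hτ
    rw [← h2]
    exact X.local_entropy_growth hb hζ hbdd hexp hs hfn h1 (by omega)

theorem kappaConst_le_one (X : PureWeightedComplex U) {b ζ : ℕ → ℝ}
    (hb : ∀ k, k < X.dim → 0 < b k) (hζ : ∀ k, k + 2 ≤ X.dim → 0 ≤ ζ k ∧ ζ k ≤ 1)
    (hbdd : X.MarginallyBounded b) {r s : ℕ} (hs : s ≤ X.dim) :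
    kappaConst b ζ r s ≤ 1 := by
  have h0 : ∀ k ∈ range s, 0 ≤ GammaConst b ζ s k := fun k hk => prod_nonneg fun j hj =>
    X.alphaConst_nonneg hb hζ hbdd (by
      have := mem_range.mp hj
      have := mem_range.mp hk
      omega)
  refine div_le_one_of_le₀ (sum_le_sum_of_subset_of_nonneg (fun k hk => ?_) fun k hk _ => h0 k hk)
    (sum_nonneg h0)
  exact mem_range.mpr (mem_Ico.mp hk).2

end PureWeightedComplex

end

/-! ### Conclusion: entropy contraction of both walks -/

theorem theorem1p12 {U : Type*} [DecidableEq U] (X : PureWeightedComplex U) (b ζ : ℕ → ℝ)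
    (hb : ∀ k, k < X.dim → 0 < b k)
    (hζ : ∀ k, k + 2 ≤ X.dim → 0 ≤ ζ k ∧ ζ k ≤ 1)
    (hbdd : X.MarginallyBounded b)
    (hexp : X.LocalSpectralExpander ζ)
    (r s : ℕ) (hrs : r < s) (hs : s ≤ X.dim) :
    ModifiedLogSobolev (X.dist s) (X.downUpWalk s r) (kappaConst b ζ r s) ∧
    ModifiedLogSobolev (X.dist r) (X.upDownWalk r s) (kappaConst b ζ r s) ∧
    (0 < kappaConst b ζ r s → ∀ ε : ℝ, 0 < ε → ε < 1 →
      mixingTime (X.dist s) (X.downUpWalk s r) ε ≤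
        (mixingBound (kappaConst b ζ r s) (X.minProb s) ε : ℕ∞) ∧
      mixingTime (X.dist r) (X.upDownWalk r s) ε ≤
        (mixingBound (kappaConst b ζ r s) (X.minProb r) ε : ℕ∞)) := by
  have hadj := X.isAdjointPair hrs.le hs
  have hκ1 := X.kappaConst_le_one hb hζ hbdd (r := r) hs
  have hup := X.chainEnt_upKernel_le hb hζ hbdd hexp hrs hs
  have hdown : ∀ f, (∀ σ, 0 ≤ f σ) → chainEnt (X.dist s) ((X.downUpWalk s r).mulVec f) ≤
      (1 - kappaConst b ζ r s) * chainEnt (X.dist s) f := fun f hf => hadj.contraction hup hf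
  have hupdown : ∀ f, (∀ σ, 0 ≤ f σ) → chainEnt (X.dist r) ((X.upDownWalk r s).mulVec f) ≤
      (1 - kappaConst b ζ r s) * chainEnt (X.dist r) f := fun f hf =>
    hadj.contraction_swap (by linarith) hup hf
  have hrev : IsReversibleChain (X.dist s) (X.downUpWalk s r) := hadj.isReversibleChain
  have hrev' : IsReversibleChain (X.dist r) (X.upDownWalk r s) := hadj.swap.isReversibleChain
  have : Nonempty (X.level s) := (X.level_nonempty hs).to_subtype
  have : Nonempty (X.level r) := (X.level_nonempty (hrs.le.trans hs)).to_subtype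
  exact ⟨hrev.modifiedLogSobolev_of_contraction hdown,
    hrev'.modifiedLogSobolev_of_contraction hupdown, fun hκ0 ε hε _ =>
      ⟨hrev.mixingTime_le hκ0 hκ1 hdown hε, hrev'.mixingTime_le hκ0 hκ1 hupdown hε⟩⟩
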